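/- Let $\kappa$ be a cardinal and assume $\mathsf{MA}(\kappa)$: for every nonempty ccc partially ordered set and every family of at most $\kappa$ of its dense subsets there is a filter meeting all members of the family. Let $K_0$ and $K_1$ be separable scattered compact Hausdorff spaces of finite height and of weight $\kappa$. Here a space $K$ is scattered if every nonempty subset $S$ of $K$ has a point isolated in $S$; $K'$ is the set of nonisolated points of $K$; and $K$ has finite height if its $n$-th Cantor--Bendixson derivative $K^{(n)}$ is empty for some natural number $n$. All Banach spaces are real, $C(K)$ is the space of continuous functions $K\to\mathbb R$ with the supremum norm, and $\simeq$ denotes linear isomorphism that is a homeomorphism. A Banach space $Z$ is a twisted sum of the Banach spaces $Y$ and $X$ if there is a short exact sequence $0\to Y\to Z\to X\to 0$ of bounded linear operators. (1) If $C(K_0')\simeq C(K_1')$, then $C(K_0)\simeq C(K_1)$. (2) If $C(K_0)\simeq C(K_1)$, then $X_0\simeq X_1$ for all Banach spaces $X_0$, $X_1$ such that $X_i$ is a twisted sum $0\to c_0\to X_i\to C(K_i)\to 0$ for $i=0,1$. (3) Moreover, in the situation of (2), all iterated twisted sums of $X_0$ and of $X_1$ with $c_0$ are isomorphic: $Z_0\simeq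 Z_1$ whenever, for $i=0,1$, the Banach space $Z_i$ is the last term of a finite sequence of Banach spaces $X_i=W_{i,0},W_{i,1},\dots,W_{i,n_i}=Z_i$ with $n_i\ge 1$ in which every $W_{i,k+1}$ is a twisted sum of $c_0$ and $W_{i,k}$ in either order, that is, there is an exact sequence $0\to c_0\to W_{i,k+1}\to W_{i,k}\to 0$ or $0\to W_{i,k}\to W_{i,k+1}\to c_0\to 0$. (The numbers $n_0$ and $n_1$ of steps need not be equal.) -/

import Mathlib

open Set Topology TopologicalSpace Cardinal CantorBendixson
open scoped ZeroAtInfty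

universe u v w v₀ v₁ w₀ w₁

/-- Two conditions `p`, `q` of a partial order are compatible if they have a common extension
(stronger conditions are smaller). -/
def ForcingCompatible {P : Type u} [PartialOrder P] (p q : P) : Prop :=
  ∃ r : P, r ≤ p ∧ r ≤ q

/-- The countable chain condition for a partial order: every set of pairwise incompatible
conditions is countable. -/
def ForcingCCC (P : Type u) [PartialOrder P] : Prop :=
  ∀ A : Set P, A.Pairwise (fun p q => ¬ ForcingCompatible p q) → A.Countable

/-- `D` is dense in the partial order `P`: every condition has an extension in `D`. -/
def ForcingDense {P : Type u} [PartialOrder P] (D : Set P) : Prop :=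
  ∀ p : P, ∃ q ∈ D, q ≤ p

/-- Martin's axiom `MA(κ)`: for every nonempty ccc partial order and every family of at most `κ`
dense sets there is a filter that meets every member of the family. -/
def MartinAxiom (κ : Cardinal.{u}) : Prop :=
  ∀ (P : Type u) [PartialOrder P] [Nonempty P], ForcingCCC P →
    ∀ 𝒟 : Set (Set P), #𝒟 ≤ κ → (∀ D ∈ 𝒟, ForcingDense D) →
      ∃ G : Order.PFilter P, ∀ D ∈ 𝒟, ∃ p ∈ D, p ∈ G

/-- The weight of a topological space: the least cardinality of a base. -/
noncomputable def topWeight (K : Type u) [TopologicalSpace K] : Cardinal.{u} :=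
  sInf {c | ∃ B : Set (Set K), IsTopologicalBasis B ∧ #B = c}

/-- A space is scattered if every nonempty subset has a point that is isolated in the subset. -/
def IsScatteredSpace (K : Type u) [TopologicalSpace K] : Prop :=
  ∀ S : Set K, S.Nonempty → ∃ x ∈ S, ¬ AccPt x (Filter.principal S)

/-- The space has finite height: some Cantor-Bendixson derivative `K⁽ⁿ⁾`, `n` finite, is empty. -/
def HasFiniteHeight (K : Type u) [TopologicalSpace K] : Prop :=
  ∃ n : ℕ, iteratedDerivedSet (univ : Set K) (n : Ordinal) = ∅

/-- `Z` is a twisted sum of `Y` and `X`: there is a short exact sequence `0 → Y → Z → X → 0` of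
bounded linear operators. -/
def IsTwistedSum (Y : Type u) (Z : Type v) (X : Type w)
    [NormedAddCommGroup Y] [NormedSpace ℝ Y] [NormedAddCommGroup Z] [NormedSpace ℝ Z]
    [NormedAddCommGroup X] [NormedSpace ℝ X] : Prop :=
  ∃ (j : Y →L[ℝ] Z) (ρ : Z →L[ℝ] X),
    Function.Injective j ∧ Function.Exact j ρ ∧ Function.Surjective ρ

/-- `Z` is a twisted sum of `c₀` and `X`, with either of the two as the subspace. -/
def IsTwistedSumWithC0 (Z : Type v) (X : Type w)
    [NormedAddCommGroup Z] [NormedSpace ℝ Z] [NormedAddCommGroup X] [NormedSpace ℝ X] : Prop :=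
  IsTwistedSum C₀(ℕ, ℝ) Z X ∨ IsTwistedSum X Z C₀(ℕ, ℝ)

/-- The Banach spaces `Z` that are obtained from `X` by forming twisted sums with `c₀`
finitely many (at least one) times. -/
inductive IsIteratedTwistedSum (X : Type w) [NormedAddCommGroup X] [NormedSpace ℝ X] :
    (Z : Type v) → [NormedAddCommGroup Z] → [NormedSpace ℝ Z] → Prop
  | base (Z : Type v) [NormedAddCommGroup Z] [NormedSpace ℝ Z] [CompleteSpace Z] :
      IsTwistedSumWithC0 Z X → IsIteratedTwistedSum X Z
  | step (W Z : Type v) [NormedAddCommGroup W] [NormedSpace ℝ W] [CompleteSpace W]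
      [NormedAddCommGroup Z] [NormedSpace ℝ Z] [CompleteSpace Z] :
      IsIteratedTwistedSum X W → IsTwistedSumWithC0 Z W → IsIteratedTwistedSum X Z

/-! The core is an extension theorem: under Martin's axiom, c₀-valued operators extend along exact
sequences 0 → Y → Z → C(K) → 0 (`MartinAxiom.exists_extension_of_hasFiniteHeight`). Taking the
identity of c₀, every twisted sum 0 → c₀ → X → C(K) → 0 splits, X ≃ c₀ ⊕ C(K), and (2) follows.

To extend T, lift its coordinates to uniformly bounded functionals φₙ on Z and correct them by
bounded functionals of the quotient until they tend to 0 pointwise. Since K is separable, a ball of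
C(K)* has a countable weak-star dense subset, so a correction is coded by a sequence of natural
numbers. Such a sequence is forced by conditions made of a finite stem and a finite set of functions
to be respected later. There are countably many stems, so ccc holds once conditions with equal stems
are compatible. This asks that bounds of a functional on the spans of two finite families give a
bound on the sum of the spans, with a constant that does not depend on the families
(`HasAmalgamation`). In C(K) this is proved level by level along the Cantor–Bendixson derivatives,
for a triangular family of functions and suitably enlarged finite sets (`exists_amalgamation`,
`exists_good`). The weight bounds the number of points of K, hence of dense sets.

For (1), C(K) is a twisted sum of c₀ and C(K'). The pullback of the two sequences over the common
quotient splits in both directions, so c₀ ⊕ C(K₀) ≃ c₀ ⊕ C(K₁), and the summand c₀ is absorbed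
because an infinite K carries a complemented copy of c₀ in C(K).

For (3), every iterate is again c₀ ⊕ C(K). With c₀ as subspace, operators are extended in two stages
(`MartinAxiom.exists_extension_prod`). With c₀ as quotient, Sobczyk's theorem handles the c₀ part
and `IsScatteredFiltration.exists_extension` the C(K) part; neither of these needs Martin's axiom
beyond ℵ₀. -/

/-! ### Martin's axiom and selectors -/

/-- The Rasiowa–Sikorski lemma. -/
theorem martinAxiom_aleph0 : MartinAxiom.{u} ℵ₀ := by
  intro P _ _ _ 𝒟 h𝒟 hdense
  obtain ⟨p⟩ := ‹Nonempty P›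
  have hc : Countable 𝒟 := mk_le_aleph0_iff.1 h𝒟
  have := Encodable.ofCountable 𝒟
  let C : 𝒟 → Order.Cofinal Pᵒᵈ := fun D =>
    ⟨OrderDual.ofDual ⁻¹' D.1, fun a => by
      obtain ⟨q, hq, hqa⟩ := hdense D.1 D.2 (OrderDual.ofDual a)
      exact ⟨OrderDual.toDual q, hq, hqa⟩⟩
  refine ⟨⟨Order.idealOfCofinals (OrderDual.toDual p) C⟩, fun D hD => ?_⟩
  obtain ⟨x, hx, hx'⟩ := Order.cofinal_meets_idealOfCofinals (OrderDual.toDual p) C ⟨D, hD⟩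
  exact ⟨OrderDual.ofDual x, hx, hx'⟩

/-- Allows finite κ, that is finite K, in a forcing argument that always uses countably many dense
sets. -/
theorem MartinAxiom.max_aleph0 {κ : Cardinal.{u}} (h : MartinAxiom κ) :
    MartinAxiom (max κ ℵ₀) := by
  rcases le_total κ ℵ₀ with h' | h'
  · rw [max_eq_right h']; exact martinAxiom_aleph0
  · rwa [max_eq_left h']

theorem exists_list_extension {Q : ℕ → ℕ → Prop} (s : List ℕ)
    (hQ : ∀ n, s.length ≤ n → ∃ d, Q n d) (N : ℕ) :
    ∃ t : List ℕ, s <+: t ∧ N ≤ t.length ∧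
      ∀ n (h : n < t.length), s.length ≤ n → Q n t[n] := by
  induction N with
  | zero => exact ⟨s, List.prefix_rfl, Nat.zero_le _, fun n h h' => absurd h (by omega)⟩
  | succ N ih =>
    obtain ⟨t, hst, hN, ht⟩ := ih
    obtain ⟨d, hd⟩ := hQ t.length hst.length_le
    refine ⟨t ++ [d], hst.trans (List.prefix_append _ _), by simp; omega, fun n h hn => ?_⟩
    rcases lt_or_ge n t.length with hlt | hge
    · rw [List.getElem_append_left hlt]; exact ht n hlt hn
    · have : n = t.length := by simp at h; omega
      subst this
      simpa using hd

/-- Finite partial selectors `s`, with a finite set `F` of requirements that are to be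
respected from position `s.length` on. -/
@[ext]
structure SelectorCondition {ι : Type u} (R : ι → ℕ → ℕ → Prop) (good : Set (Finset ι))
    (bd : Finset ι → ℕ → Prop) where
  s : List ℕ
  F : Finset ι
  mem_good : F ∈ good
  promise : ∀ n, s.length ≤ n → bd F n

namespace SelectorCondition

variable {ι : Type u} {R : ι → ℕ → ℕ → Prop} {good : Set (Finset ι)} {bd : Finset ι → ℕ → Prop}

instance : PartialOrder (SelectorCondition R good bd) where
  le q p := p.s <+: q.s ∧ p.F ⊆ q.F ∧
    ∀ n (h : n < q.s.length), p.s.length ≤ n → ∀ i ∈ p.F, R i n q.s[n]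
  le_refl p := ⟨List.prefix_rfl, Finset.Subset.refl _, fun n h h' => absurd h (by omega)⟩
  le_trans r q p hrq hqp := by
    refine ⟨hqp.1.trans hrq.1, hqp.2.1.trans hrq.2.1, fun n h hn i hi => ?_⟩
    rcases lt_or_ge n q.s.length with hq | hq
    · have := hqp.2.2 n hq hn i hi
      rwa [hrq.1.getElem hq] at this
    · exact hrq.2.2 n h hq i (hqp.2.1 hi)
  le_antisymm p q hpq hqp := by
    ext1
    · exact (hqp.1.eq_of_length (le_antisymm hqp.1.length_le hpq.1.length_le))
    · exact Finset.Subset.antisymm hqp.2.1 hpq.2.1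

/-- A good set containing both promises is kept only from some position on. Up to there the stem is
lengthened using the two old promises alone, which `hR` reconciles at each position. This one lemma
gives both ccc and density. -/
theorem exists_common_extension (hcof : ∀ F₀ : Finset ι, ∃ F ∈ good, F₀ ⊆ F)
    (hbd : ∀ F ∈ good, ∀ᶠ n in Filter.atTop, bd F n)
    (hR : ∀ F₁ ∈ good, ∀ F₂ ∈ good, ∀ n, bd F₁ n → bd F₂ n →
      ∃ d, (∀ i ∈ F₁, R i n d) ∧ ∀ i ∈ F₂, R i n d)
    (p q : SelectorCondition R good bd) (h : p.s = q.s) (F₀ : Finset ι) (m : ℕ) :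
    ∃ t : SelectorCondition R good bd, t ≤ p ∧ t ≤ q ∧ F₀ ⊆ t.F ∧ m ≤ t.s.length := by
  classical
  obtain ⟨F, hF, hsub⟩ := hcof (p.F ∪ q.F ∪ F₀)
  obtain ⟨N, hN⟩ := Filter.eventually_atTop.1 (hbd F hF)
  obtain ⟨t, hst, hlen, ht⟩ := exists_list_extension
    (Q := fun n d => (∀ i ∈ p.F, R i n d) ∧ ∀ i ∈ q.F, R i n d) p.s
    (fun n hn => hR _ p.mem_good _ q.mem_good n (p.promise n hn) (q.promise n (h ▸ hn)))
    (max N m)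
  have hNt := le_trans (le_max_left _ _) hlen
  refine ⟨⟨t, F, hF, fun n hn => hN n (hNt.trans hn)⟩, ⟨hst, ?_, fun n h hn => (ht n h hn).1⟩,
    ⟨h ▸ hst, ?_, fun n h' hn => (ht n h' (h ▸ hn)).2⟩, ?_, le_trans (le_max_right _ _) hlen⟩
  all_goals
    refine Finset.Subset.trans ?_ hsub
    intro i hi
    simp [hi]

end SelectorCondition

/-- Under Martin's axiom there is a sequence `g` that meets each of `κ` requirements at almost
all positions, provided that any two promises that are kept at a position
can be respected simultaneously there. -/
theorem MartinAxiom.exists_selector {κ : Cardinal.{u}} (hMA : MartinAxiom κ) (hκ : ℵ₀ ≤ κ)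
    {ι : Type u} (hι : #ι ≤ κ) (R : ι → ℕ → ℕ → Prop) (good : Set (Finset ι))
    (bd : Finset ι → ℕ → Prop) (hcof : ∀ F₀ : Finset ι, ∃ F ∈ good, F₀ ⊆ F)
    (hbd : ∀ F ∈ good, ∀ᶠ n in Filter.atTop, bd F n)
    (hR : ∀ F₁ ∈ good, ∀ F₂ ∈ good, ∀ n, bd F₁ n → bd F₂ n →
      ∃ d, (∀ i ∈ F₁, R i n d) ∧ ∀ i ∈ F₂, R i n d) :
    ∃ g : ℕ → ℕ, ∀ i, ∀ᶠ n in Filter.atTop, R i n (g n) := by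
  classical
  let P := SelectorCondition R good bd
  have ext := SelectorCondition.exists_common_extension (R := R) hcof hbd hR
  have hne : Nonempty P := by
    obtain ⟨F, hF, -⟩ := hcof ∅
    obtain ⟨N, hN⟩ := Filter.eventually_atTop.1 (hbd F hF)
    exact ⟨⟨List.replicate N 0, F, hF, fun n hn => hN n (by simpa using hn)⟩⟩
  -- Conditions with equal stems are compatible, so an antichain injects into the countable set of
  -- stems.
  have hccc : ForcingCCC P := by
    intro A hA
    have : Function.Injective (fun p : A => p.1.s) := by
      intro p q hpq
      by_contra hne
      obtain ⟨t, h1, h2, -⟩ := ext p.1 q.1 hpq ∅ 0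
      exact hA p.2 q.2 (fun h => hne (Subtype.ext h)) ⟨t, h1, h2⟩
    exact this.countable
  let DL : ULift.{u} ℕ → Set P := fun m => {p | m.down ≤ p.s.length}
  let DF : ι → Set P := fun i => {p | i ∈ p.F}
  obtain ⟨G, hG⟩ := hMA P hccc (range DL ∪ range DF)
    (by
      refine (mk_union_le _ _).trans (add_le_of_le hκ (mk_range_le.trans ?_)
        (mk_range_le.trans hι))
      simpa using hκ)
    (by
      rintro _ (⟨m, rfl⟩ | ⟨i, rfl⟩) p
      · obtain ⟨t, h1, -, -, h2⟩ := ext p p rfl ∅ m.down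
        exact ⟨t, h2, h1⟩
      · obtain ⟨t, h1, -, h2, -⟩ := ext p p rfl {i} 0
        exact ⟨t, h2 (Finset.mem_singleton_self i), h1⟩)
  have hlen : ∀ n : ℕ, ∃ p ∈ G, n < p.s.length := fun n => by
    obtain ⟨p, hp, hpG⟩ := hG (DL ⟨n + 1⟩) (Or.inl ⟨_, rfl⟩)
    exact ⟨p, hpG, hp⟩
  choose p hpG hp using hlen
  refine ⟨fun n => (p n).s[n]'(hp n), fun i => ?_⟩
  obtain ⟨q, hq, hqG⟩ := hG (DF i) (Or.inr ⟨i, rfl⟩)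
  filter_upwards [Filter.eventually_ge_atTop q.s.length] with n hn
  obtain ⟨t, -, ht1, ht2⟩ := G.directed (p n) (hpG n) q hqG
  rw [ht1.1.getElem (hp n)]
  exact ht2.2.2 n ((hp n).trans_le ht1.1.length_le) hn i hq

/-! ### Short exact sequences of Banach spaces -/

section Exact

variable {Y : Type*} {Z : Type*} {X : Type*}
  [NormedAddCommGroup Y] [NormedSpace ℝ Y] [NormedAddCommGroup Z] [NormedSpace ℝ Z]
  [NormedAddCommGroup X] [NormedSpace ℝ X]

/-- By the open mapping theorem `j` is an isomorphism onto its closed range; then Hahn–Banach, with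
a constant common to all functionals. -/
theorem exists_bounded_functional_extension [CompleteSpace Y] [CompleteSpace Z]
    {j : Y →L[ℝ] Z} {ρ : Z →L[ℝ] X} (hj : Function.Injective j) (hex : Function.Exact j ρ) :
    ∃ C, 0 ≤ C ∧ ∀ ψ : Y →L[ℝ] ℝ, ∃ φ : Z →L[ℝ] ℝ, (∀ y, φ (j y) = ψ y) ∧ ‖φ‖ ≤ C * ‖ψ‖ := by
  have hcl : IsClosed (range j) := by
    have : range j = ρ ⁻¹' {0} := by
      ext z; exact (hex z).symm
    rw [this]
    exact isClosed_singleton.preimage ρ.continuous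
  let e := j.equivRange hj hcl
  refine ⟨‖(e.symm : j.range →L[ℝ] Y)‖, ContinuousLinearMap.opNorm_nonneg _, fun ψ => ?_⟩
  obtain ⟨φ, hφ, hn⟩ := exists_extension_norm_eq j.range (ψ.comp (e.symm : j.range →L[ℝ] Y))
  refine ⟨φ, fun y => ?_, ?_⟩
  · have := hφ (e y)
    change φ (j y) = ψ (e.symm (e y)) at this
    rwa [e.symm_apply_apply] at this
  · rw [hn, mul_comm]
    exact ContinuousLinearMap.opNorm_comp_le _ _

/-- A closed subspace containing the kernel of a quotient map has closed image. This reduces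
convergence or continuity statements on `Z` to `Y` and to lifts of a total family. -/
theorem submodule_eq_top_of_exact [CompleteSpace Z] [CompleteSpace X]
    {j : Y →L[ℝ] Z} {ρ : Z →L[ℝ] X} (hex : Function.Exact j ρ) (hρ : Function.Surjective ρ)
    (S : Submodule ℝ Z) (hS : IsClosed (S : Set Z)) (hjS : ∀ y, j y ∈ S)
    (hdense : Dense (ρ '' S)) : S = ⊤ := by
  have hker : ∀ z, ρ z = 0 → z ∈ S := fun z hz => by
    obtain ⟨y, rfl⟩ := (hex z).1 hz
    exact hjS y
  have hpre : ρ ⁻¹' (ρ '' S) = S := by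
    ext z
    refine ⟨?_, fun h => ⟨z, h, rfl⟩⟩
    rintro ⟨s, hs, hsz⟩
    have := S.add_mem (hker (z - s) (by rw [map_sub, hsz, sub_self])) hs
    simpa using this
  have hq := (ρ.isOpenMap hρ).isQuotientMap ρ.continuous hρ
  have hclosed : IsClosed (ρ '' S) := by
    rw [← hq.isClosed_preimage, hpre]
    exact hS
  have : ρ '' S = Set.univ := by rw [← hclosed.closure_eq, hdense.closure_eq]
  rw [this, preimage_univ] at hpre
  exact SetLike.coe_injective (by simpa using hpre.symm)

theorem nonempty_equiv_prod_of_retraction [CompleteSpace Y] [CompleteSpace Z] [CompleteSpace X]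
    {j : Y →L[ℝ] Z} {ρ : Z →L[ℝ] X} (hex : Function.Exact j ρ) (hρ : Function.Surjective ρ)
    (P : Z →L[ℝ] Y) (hP : ∀ y, P (j y) = y) : Nonempty (Z ≃L[ℝ] Y × X) := by
  refine ⟨ContinuousLinearMap.equivProdOfSurjectiveOfIsCompl P ρ ?_ ?_ ?_⟩
  · exact LinearMap.range_eq_top.2 fun y => ⟨j y, hP y⟩
  · exact LinearMap.range_eq_top.2 hρ
  · refine IsCompl.of_eq ?_ ?_
    · refine (Submodule.eq_bot_iff _).2 fun z hz => ?_
      obtain ⟨h1, h2⟩ := Submodule.mem_inf.1 hz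
      obtain ⟨y, rfl⟩ := (hex z).1 h2
      have : y = 0 := by rw [← hP y]; exact h1
      simp [this]
    · refine (Submodule.eq_top_iff').2 fun z => ?_
      refine Submodule.mem_sup.2 ⟨z - j (P z), ?_, j (P z), ?_, by simp⟩
      · simp [hP]
      · exact (hex _).2 ⟨_, rfl⟩

end Exact

/-! ### Countable weak-star dense sets of functionals -/

section Norming

variable {X : Type*} [NormedAddCommGroup X] [NormedSpace ℝ X]

/-- A set of functionals in the dual unit ball that determines the norm. -/
def IsNorming (N : Set (X →L[ℝ] ℝ)) : Prop :=
  (∀ ν ∈ N, ‖ν‖ ≤ 1) ∧ ∀ x : X, ∀ c : ℝ, 0 ≤ c → (∀ ν ∈ N, |ν x| ≤ c) → ‖x‖ ≤ c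

/-- The bipolar theorem: the convex hull of ±rN is weak-star dense in the ball of radius `r`. The
hull is norm separable, so countably many of its elements suffice. -/
theorem IsNorming.exists_seq_approx {N : Set (X →L[ℝ] ℝ)} (hN : IsNorming N) (hc : N.Countable)
    {r : ℝ} (hr : 0 < r) :
    ∃ ν : ℕ → X →L[ℝ] ℝ, (∀ k, ‖ν k‖ ≤ r) ∧ ∀ μ : X →L[ℝ] ℝ, ‖μ‖ ≤ r → ∀ F : Set X, F.Finite →
      ∀ ε > 0, ∃ k, ∀ x ∈ F, |μ x - ν k x| < ε := by
  classical
  let S₀ : Set (X →L[ℝ] ℝ) := insert 0 (((fun ν => r • ν) '' N) ∪ ((fun ν => -(r • ν)) '' N))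
  let S := convexHull ℝ S₀
  have hS₀c : S₀.Countable := ((hc.image _).union (hc.image _)).insert 0
  have hSsep : IsSeparable S :=
    (hS₀c.isSeparable.span (R := ℝ)).mono ((convexHull_min Submodule.subset_span (Submodule.convex _)))
  obtain ⟨t, htS, htc, hSt⟩ := hSsep.exists_countable_dense_subset
  have h0S : (0 : X →L[ℝ] ℝ) ∈ S := subset_convexHull _ _ (mem_insert _ _)
  have htne : t.Nonempty := by
    rw [← closure_nonempty_iff]
    exact ⟨0, hSt h0S⟩
  obtain ⟨ν, rfl⟩ := htc.exists_eq_range htne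
  have hSr : ∀ μ ∈ S, ‖μ‖ ≤ r := by
    have : S ⊆ Metric.closedBall 0 r := by
      refine convexHull_min ?_ (convex_closedBall _ _)
      rintro _ (rfl | ⟨μ, hμ, rfl⟩ | ⟨μ, hμ, rfl⟩)
      · exact Metric.mem_closedBall_self hr.le
      all_goals
        rw [mem_closedBall_zero_iff]
        first
        | rw [norm_neg, norm_smul, Real.norm_of_nonneg hr.le]
        | rw [norm_smul, Real.norm_of_nonneg hr.le]
        exact mul_le_of_le_one_right hr.le (hN.1 μ hμ)
    exact fun μ hμ => mem_closedBall_zero_iff.1 (this hμ)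
  refine ⟨ν, fun k => hSr _ (htS ⟨k, rfl⟩), fun μ hμ F hF ε hε => ?_⟩
  have := hF.fintype
  let T : (X →L[ℝ] ℝ) →L[ℝ] (F → ℝ) :=
    ContinuousLinearMap.pi fun x => ContinuousLinearMap.apply ℝ ℝ (x : X)
  have hT : ∀ (μ : X →L[ℝ] ℝ) (x : F), T μ x = μ x := fun _ _ => rfl
  have key : T μ ∈ closure (T '' S) := by
    by_contra hnot
    have hTS : Convex ℝ (T '' S) := (convex_convexHull ℝ S₀).linear_image T.toLinearMap
    have hconv : Convex ℝ (closure (T '' S)) := hTS.closure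
    obtain ⟨f, c, hfc, hfμ⟩ := geometric_hahn_banach_closed_point hconv isClosed_closure hnot
    -- The separating functional on ℝ^F is evaluation at this vector. Norming bounds its norm by `c
    -- / r`, which contradicts `c < μ x`.
    let x : X := ∑ i : F, f (Pi.single i 1) • (i : X)
    have hfT : ∀ ξ : X →L[ℝ] ℝ, f (T ξ) = ξ x := by
      intro ξ
      conv_lhs => rw [← Finset.univ_sum_single (T ξ)]
      simp only [x, map_sum, map_smul, smul_eq_mul, hT]
      refine Finset.sum_congr rfl fun i _ => ?_
      have : (Pi.single i (ξ (i : X)) : F → ℝ) = ξ (i : X) • Pi.single i 1 := by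
        rw [← Pi.single_smul]; simp
      rw [this, map_smul, smul_eq_mul, mul_comm]
    have hlt : ∀ ξ ∈ S₀, ξ x < c := fun ξ hξ => by
      rw [← hfT]
      exact hfc _ (subset_closure ⟨ξ, subset_convexHull _ _ hξ, rfl⟩)
    rw [hfT] at hfμ
    have hc0 : 0 < c := by simpa using hlt 0 (mem_insert _ _)
    have hx : ‖x‖ ≤ c / r := by
      refine hN.2 x _ (by positivity) fun ξ hξ => ?_
      have h1 := hlt (r • ξ) (Or.inr (Or.inl ⟨ξ, hξ, rfl⟩))
      have h2 := hlt (-(r • ξ)) (Or.inr (Or.inr ⟨ξ, hξ, rfl⟩))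
      simp only [neg_apply, smul_apply,
        smul_eq_mul] at h1 h2
      rw [le_div_iff₀ hr, ← abs_of_pos hr, ← abs_mul, abs_le]
      constructor <;> nlinarith
    have := (le_abs_self _).trans ((μ.le_opNorm x).trans
      (mul_le_mul hμ hx (norm_nonneg _) hr.le))
    rw [mul_div_cancel₀ _ hr.ne'] at this
    exact absurd this (not_le.2 hfμ)
  have key2 : T μ ∈ closure (T '' range ν) := by
    refine closure_minimal ?_ isClosed_closure key
    refine (image_mono hSt).trans (image_closure_subset_closure_image T.continuous)
  obtain ⟨_, ⟨_, ⟨k, rfl⟩, rfl⟩, hk⟩ := Metric.mem_closure_iff.1 key2 ε hε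
  refine ⟨k, fun x hx => ?_⟩
  have := (dist_le_pi_dist (T μ) (T (ν k)) ⟨x, hx⟩).trans_lt hk
  simpa [Real.dist_eq, hT] using this

end Norming

/-! ### The space `c₀` -/

namespace CZero

theorem tendsto_atTop (a : C₀(ℕ, ℝ)) : Filter.Tendsto (fun n => a n) Filter.atTop (𝓝 0) := by
  have := a.zero_at_infty'
  rwa [Filter.cocompact_eq_cofinite, Nat.cofinite_eq_atTop] at this

theorem abs_apply_le (a : C₀(ℕ, ℝ)) (n : ℕ) : |a n| ≤ ‖a‖ := by
  rw [← ZeroAtInftyContinuousMap.norm_toBCF_eq_norm]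
  exact a.toBCF.norm_coe_le_norm n

theorem norm_le {a : C₀(ℕ, ℝ)} {c : ℝ} (hc : 0 ≤ c) (h : ∀ n, |a n| ≤ c) : ‖a‖ ≤ c := by
  rw [← ZeroAtInftyContinuousMap.norm_toBCF_eq_norm]
  exact (BoundedContinuousFunction.norm_le hc).2 h

/-- The element of `c₀` given by a null sequence. -/
def mk (a : ℕ → ℝ) (h : Filter.Tendsto a Filter.atTop (𝓝 0)) : C₀(ℕ, ℝ) where
  toFun := a
  continuous_toFun := continuous_of_discreteTopology
  zero_at_infty' := by rwa [Filter.cocompact_eq_cofinite, Nat.cofinite_eq_atTop]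

@[simp]
theorem mk_apply (a : ℕ → ℝ) (h : Filter.Tendsto a Filter.atTop (𝓝 0)) (n : ℕ) :
    mk a h n = a n := rfl

/-- Coordinate functionals on `c₀`. -/
noncomputable def coord (n : ℕ) : C₀(ℕ, ℝ) →L[ℝ] ℝ :=
  LinearMap.mkContinuous ⟨⟨fun a => a n, fun _ _ => rfl⟩, fun _ _ => rfl⟩ 1
    fun a => by simpa using abs_apply_le a n

@[simp]
theorem coord_apply (n : ℕ) (a : C₀(ℕ, ℝ)) : coord n a = a n := rfl

theorem norm_coord_le (n : ℕ) : ‖coord n‖ ≤ 1 :=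
  LinearMap.mkContinuous_norm_le _ zero_le_one _

variable {Z : Type*} [NormedAddCommGroup Z] [NormedSpace ℝ Z]

theorem exists_operator (ψ : ℕ → Z →ₗ[ℝ] ℝ) (M : ℝ) (hM : ∀ n z, |ψ n z| ≤ M * ‖z‖)
    (hψ : ∀ z, Filter.Tendsto (fun n => ψ n z) Filter.atTop (𝓝 0)) :
    ∃ P : Z →L[ℝ] C₀(ℕ, ℝ), ∀ z n, P z n = ψ n z := by
  refine ⟨LinearMap.mkContinuous ⟨⟨fun z => mk (fun n => ψ n z) (hψ z), fun a b => ?_⟩,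
    fun c a => ?_⟩ M fun z => ?_, fun z n => rfl⟩
  · ext n; simp
  · ext n; simp
  · exact norm_le ((abs_nonneg _).trans (hM 0 z)) fun n => hM n z

/-- The unit vectors of `c₀`. -/
noncomputable def single (n : ℕ) : C₀(ℕ, ℝ) :=
  mk (Pi.single n 1) (tendsto_const_nhds.congr' (by
    filter_upwards [Filter.eventually_gt_atTop n] with m hm
    simp [hm.ne']))

theorem single_apply (n m : ℕ) : single n m = if m = n then 1 else 0 := by
  simp [single, Pi.single_apply]

theorem sum_single_apply (c : ℕ → ℝ) (N m : ℕ) :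
    (∑ n ∈ Finset.range N, c n • single n) m = if m < N then c m else 0 := by
  rw [← coord_apply, map_sum]
  simp [single_apply]

theorem dense_span_single : Dense (Submodule.span ℝ (range single) : Set C₀(ℕ, ℝ)) := by
  intro a
  rw [Metric.mem_closure_iff]
  intro ε hε
  obtain ⟨N, hN⟩ := Filter.eventually_atTop.1
    ((tendsto_atTop a).eventually (Metric.ball_mem_nhds 0 (half_pos hε)))
  refine ⟨∑ n ∈ Finset.range N, a n • single n, Submodule.sum_mem _ fun n _ =>
    Submodule.smul_mem _ _ (Submodule.subset_span ⟨n, rfl⟩), ?_⟩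
  rw [dist_eq_norm]
  refine (norm_le (half_pos hε).le fun m => ?_).trans_lt (half_lt_self hε)
  rw [ZeroAtInftyContinuousMap.sub_apply, sum_single_apply]
  split_ifs with h
  · rw [sub_self, abs_zero]; exact (half_pos hε).le
  · simpa using (hN m (not_lt.1 h)).le

end CZero

/-! ### Extension of `c₀`-valued operators -/

section Amalgamation

variable {X : Type*} [NormedAddCommGroup X] [NormedSpace ℝ X]

/-- The spans of `good` finite subfamilies of the family `x` can be amalgamated uniformly. -/
def HasAmalgamation {ι : Type*} (x : ι → X) : Prop :=
  ∃ (good : Set (Finset ι)) (C : ℝ), 0 ≤ C ∧ (∀ F₀ : Finset ι, ∃ F ∈ good, F₀ ⊆ F) ∧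
    ∀ F₁ ∈ good, ∀ F₂ ∈ good, ∀ f ∈ Submodule.span ℝ (x '' F₁), ∀ g ∈ Submodule.span ℝ (x '' F₂),
      ∃ h ∈ Submodule.span ℝ (x '' F₁) ⊓ Submodule.span ℝ (x '' F₂), ‖f - h‖ ≤ C * ‖f + g‖

/-- A finite net in the unit sphere makes the pointwise asymptotic bound uniform. The extra 2 is 1
for `δ` and 1 for the distance to the net, whose mesh is adapted to the crude bound `B`. -/
theorem eventually_abs_le_of_finiteDimensional (E : Submodule ℝ X) [FiniteDimensional ℝ E]
    (c : ℕ → X →ₗ[ℝ] ℝ) {A B : ℝ} (hB0 : 0 ≤ B) (hB : ∀ n, ∀ f ∈ E, |c n f| ≤ B * ‖f‖)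
    (hA : ∀ f, ∀ δ > 0, ∀ᶠ n in Filter.atTop, |c n f| ≤ A * ‖f‖ + δ) :
    ∀ᶠ n in Filter.atTop, ∀ f ∈ E, |c n f| ≤ (A + 2) * ‖f‖ := by
  have : ProperSpace E := FiniteDimensional.proper ℝ E
  obtain ⟨t, hts, htf, htc⟩ := (isCompact_sphere (0 : E) 1).finite_cover_balls
    (e := 1 / (B + 1)) (by positivity)
  have hev : ∀ᶠ n in Filter.atTop, ∀ f ∈ t, |c n f| ≤ A * ‖(f : X)‖ + 1 :=
    (Filter.eventually_all_finite htf).2 fun f _ => hA f 1 one_pos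
  filter_upwards [hev] with n hn f hf
  have hunit : ∀ f ∈ E, ‖f‖ = 1 → |c n f| ≤ A + 2 := by
    intro f hf hf1
    have hmem : (⟨f, hf⟩ : E) ∈ Metric.sphere (0 : E) 1 := by simpa using hf1
    obtain ⟨g, hg, hfg⟩ := mem_iUnion₂.1 (htc hmem)
    have hg1 : ‖(g : X)‖ = 1 := by simpa using hts hg
    have h1 := hn g hg
    have h2 := hB n (f - g) (E.sub_mem hf g.2)
    have h3 : ‖f - g‖ ≤ 1 / (B + 1) := by
      have := (Metric.mem_ball.1 hfg).le
      rwa [dist_eq_norm] at this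
    have h4 : B * ‖f - g‖ ≤ 1 := by
      refine (mul_le_mul_of_nonneg_left h3 hB0).trans ?_
      rw [mul_one_div, div_le_one (by positivity)]
      linarith
    have h5 : c n f = c n (f - g) + c n g := by rw [map_sub]; ring
    rw [h5]
    refine (abs_add_le _ _).trans ?_
    rw [hg1] at h1
    linarith
  rcases eq_or_ne f 0 with rfl | hf0
  · simp
  · have hpos := norm_pos_iff.2 hf0
    have := hunit (‖f‖⁻¹ • f) (E.smul_mem _ hf) (by
      rw [norm_smul, norm_inv, norm_norm, inv_mul_cancel₀ hpos.ne'])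
    rw [map_smul, smul_eq_mul, abs_mul, abs_of_pos (inv_pos.2 hpos), inv_mul_le_iff₀ hpos] at this
    linarith

theorem exists_functional_of_bound_on_span (E : Submodule ℝ X) (c : X →ₗ[ℝ] ℝ) {R : ℝ} (hR : 0 ≤ R)
    (h : ∀ f ∈ E, |c f| ≤ R * ‖f‖) : ∃ μ : X →L[ℝ] ℝ, ‖μ‖ ≤ R ∧ ∀ f ∈ E, μ f = c f := by
  let c' : E →L[ℝ] ℝ := LinearMap.mkContinuous (c.comp E.subtype) R fun f => h f f.2
  obtain ⟨μ, hμ, hn⟩ := exists_extension_norm_eq E c'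
  exact ⟨μ, hn.trans_le (LinearMap.mkContinuous_norm_le _ hR _), fun f hf => hμ ⟨f, hf⟩⟩

variable {Y : Type*} {Z : Type*}
  [NormedAddCommGroup Y] [NormedSpace ℝ Y] [NormedAddCommGroup Z] [NormedSpace ℝ Z]

/-- Under Martin's axiom, `c₀`-valued operators extend along exact sequences whose quotient
has a countable norming set of functionals and a total family with uniform amalgamation. -/
theorem MartinAxiom.exists_extension_czero {κ : Cardinal.{u}} (hMA : MartinAxiom κ) (hκ : ℵ₀ ≤ κ)
    {ι : Type u} (hι : #ι ≤ κ) {x : ι → X} (hx : Dense (Submodule.span ℝ (range x) : Set X))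
    (hamalg : HasAmalgamation x) {N : Set (X →L[ℝ] ℝ)} (hN : IsNorming N) (hNc : N.Countable)
    [CompleteSpace X] [CompleteSpace Y] [CompleteSpace Z]
    {j : Y →L[ℝ] Z} {ρ : Z →L[ℝ] X} (hj : Function.Injective j) (hex : Function.Exact j ρ)
    (hρ : Function.Surjective ρ) (T : Y →L[ℝ] C₀(ℕ, ℝ)) :
    ∃ P : Z →L[ℝ] C₀(ℕ, ℝ), ∀ y, P (j y) = T y := by
  obtain ⟨good, C, hC, hcof, ham⟩ := hamalg
  obtain ⟨C₁, hC₁, hext⟩ := exists_bounded_functional_extension hj hex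
  choose φ hφ hφn using fun n => hext ((CZero.coord n).comp T)
  obtain ⟨C₂, hC₂, hlift⟩ := ρ.exists_preimage_norm_le hρ
  -- A merely linear section is enough: its continuity is only used on finite-dimensional subspaces.
  obtain ⟨σ, hσ⟩ := (ρ : Z →ₗ[ℝ] X).exists_rightInverse_of_surjective (LinearMap.range_eq_top.2 hρ)
  replace hσ : ∀ f, ρ (σ f) = f := fun f => LinearMap.congr_fun hσ f
  obtain ⟨M, hM0, hφM⟩ : ∃ M, 0 ≤ M ∧ ∀ n z, |φ n z| ≤ M * ‖z‖ := by
    refine ⟨C₁ * ‖T‖, by positivity, fun n z => ?_⟩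
    refine (φ n).le_of_opNorm_le ((hφn n).trans ?_) z
    refine mul_le_mul_of_nonneg_left ((ContinuousLinearMap.opNorm_comp_le _ _).trans ?_) hC₁
    exact mul_le_of_le_one_left (norm_nonneg _) (CZero.norm_coord_le n)
  have hφj : ∀ y, Filter.Tendsto (fun n => φ n (j y)) Filter.atTop (𝓝 0) := fun y => by
    simpa [hφ] using CZero.tendsto_atTop (T y)
  let c : ℕ → X →ₗ[ℝ] ℝ := fun n => (φ n : Z →ₗ[ℝ] ℝ).comp σ
  have hc : ∀ n f, c n f = φ n (σ f) := fun _ _ => rfl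
  set r := M * C₂ + 2 with hr
  have hr0 : 0 < r := by positivity
  let bd : Finset ι → ℕ → Prop := fun F n => ∀ f ∈ Submodule.span ℝ (x '' F), |c n f| ≤ r * ‖f‖
  have hbd : ∀ F : Finset ι, ∀ᶠ n in Filter.atTop, bd F n := by
    intro F
    have : FiniteDimensional ℝ (Submodule.span ℝ (x '' F)) :=
      FiniteDimensional.span_of_finite ℝ (F.finite_toSet.image x)
    let σE := LinearMap.toContinuousLinearMap (σ.comp (Submodule.span ℝ (x '' F)).subtype)
    refine eventually_abs_le_of_finiteDimensional _ c (B := M * ‖σE‖) (by positivity)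
      (fun n f hf => ?_) fun f δ hδ => ?_
    · rw [mul_assoc]
      exact (hφM n _).trans (mul_le_mul_of_nonneg_left (σE.le_opNorm ⟨f, hf⟩) hM0)
    · obtain ⟨z, hz, hzn⟩ := hlift f
      -- `σ f` differs from a lift of controlled norm by an element of `Y`, on which the `φ n` tend
      -- to 0.
      obtain ⟨y, hy⟩ := (hex (σ f - z)).1 (by rw [map_sub, hσ, hz, sub_self])
      filter_upwards [(hφj y).eventually (Metric.ball_mem_nhds 0 hδ)] with n hn
      have h1 : c n f = φ n z + φ n (j y) := by rw [hc, hy, map_sub]; ring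
      rw [h1]
      refine (abs_add_le _ _).trans (add_le_add ((hφM n z).trans ?_) ?_)
      · rw [mul_assoc]
        exact mul_le_mul_of_nonneg_left hzn hM0
      · simpa using hn.le
  -- Split f + g = (f - h) + (h + g): amalgamation bounds the norms by `C` and `C + 1` times that of
  -- f + g.
  set R := (1 + 2 * C) * r with hR
  have hR0 : 0 < R := by positivity
  obtain ⟨ν, hνR, hν⟩ := hN.exists_seq_approx hNc hR0
  obtain ⟨g, hg⟩ := hMA.exists_selector hκ hι
    (fun i n d => |c n (x i) - ν d (x i)| < 1 / ((n : ℝ) + 1)) good bd hcof (fun F _ => hbd F)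
    (by
      intro F₁ hF₁ F₂ hF₂ n h1 h2
      obtain ⟨μ, hμR, hμ⟩ := exists_functional_of_bound_on_span
        (Submodule.span ℝ (x '' F₁) ⊔ Submodule.span ℝ (x '' F₂)) (c n) hR0.le (by
          intro e he
          obtain ⟨f, hf, g, hg, rfl⟩ := Submodule.mem_sup.1 he
          obtain ⟨h, hh, hfh⟩ := ham F₁ hF₁ F₂ hF₂ f hf g hg
          have e1 := h1 (f - h) (Submodule.sub_mem _ hf hh.1)
          have e2 := h2 (h + g) (Submodule.add_mem _ hh.2 hg)
          have e3 : ‖h + g‖ ≤ ‖f - h‖ + ‖f + g‖ := by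
            have : h + g = (f + g) - (f - h) := by abel
            rw [this, add_comm ‖f - h‖]
            exact norm_sub_le _ _
          have e4 : c n (f + g) = c n (f - h) + c n (h + g) := by
            rw [← map_add]; congr 1; abel
          rw [e4]
          refine (abs_add_le _ _).trans ((add_le_add e1 e2).trans ?_)
          rw [← mul_add, hR, mul_comm (1 + 2 * C), mul_assoc]
          refine mul_le_mul_of_nonneg_left ?_ hr0.le
          linarith)
      obtain ⟨k, hk⟩ := hν μ hμR (x '' (F₁ ∪ F₂ : Set ι))
        ((F₁.finite_toSet.union F₂.finite_toSet).image x) (1 / ((n : ℝ) + 1)) (by positivity)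
      refine ⟨k, fun i hi => ?_, fun i hi => ?_⟩
      · rw [← hμ _ (Submodule.mem_sup_left (Submodule.subset_span (mem_image_of_mem x hi)))]
        exact hk _ ⟨i, Or.inl hi, rfl⟩
      · rw [← hμ _ (Submodule.mem_sup_right (Submodule.subset_span (mem_image_of_mem x hi)))]
        exact hk _ ⟨i, Or.inr hi, rfl⟩)
  let ψ : ℕ → Z →ₗ[ℝ] ℝ := fun n => (φ n - (ν (g n)).comp ρ : Z →L[ℝ] ℝ)
  have hψ : ∀ n z, ψ n z = φ n z - ν (g n) (ρ z) := fun _ _ => rfl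
  have hρj : ∀ y, ρ (j y) = 0 := fun y => (hex _).2 ⟨y, rfl⟩
  have hψM : ∀ n z, |ψ n z| ≤ (M + R * ‖ρ‖) * ‖z‖ := fun n z => by
    rw [hψ, add_mul, mul_assoc R]
    refine (abs_sub _ _).trans (add_le_add (hφM n z) ?_)
    exact ((ν (g n)).le_of_opNorm_le (hνR _) _).trans
      (mul_le_mul_of_nonneg_left (ρ.le_opNorm z) hR0.le)
  -- The corrected functionals tend to 0 on the range of `j`, where the correction vanishes, and on
  -- the lifts `σ (x i)`, by the choice of `g`.
  let S : Submodule ℝ Z :=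
    { carrier := {z | Filter.Tendsto (fun n => ψ n z) Filter.atTop (𝓝 0)}
      zero_mem' := by simp
      add_mem' := fun {a b} ha hb => by
        simpa using Filter.Tendsto.add (show Filter.Tendsto _ _ _ from ha) hb
      smul_mem' := fun a z hz => by
        simpa using Filter.Tendsto.const_mul a (show Filter.Tendsto _ _ _ from hz) }
  have hSclosed : IsClosed (S : Set Z) := by
    refine isClosed_of_closure_subset fun z hz => ?_
    rw [Metric.mem_closure_iff] at hz
    refine Metric.tendsto_atTop.2 fun ε hε => ?_
    set B := M + R * ‖ρ‖ + 1
    have hB : 0 < B := by positivity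
    obtain ⟨z', hz', hzz⟩ := hz (ε / 2 / B) (by positivity)
    obtain ⟨n₀, hn₀⟩ := Metric.tendsto_atTop.1 (show Filter.Tendsto _ _ _ from hz') (ε / 2)
      (half_pos hε)
    refine ⟨n₀, fun n hn => ?_⟩
    have h1 := hn₀ n hn
    have h2 := hψM n (z - z')
    have h3 : (M + R * ‖ρ‖) * ‖z - z'‖ ≤ ε / 2 := by
      rw [dist_eq_norm, lt_div_iff₀ hB] at hzz
      nlinarith [norm_nonneg (z - z')]
    rw [dist_zero_right, Real.norm_eq_abs] at h1 ⊢
    have h4 : ψ n z = ψ n (z - z') + ψ n z' := by rw [map_sub]; ring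
    rw [h4]
    exact (abs_add_le _ _).trans_lt (by linarith)
  have hStop : S = ⊤ := by
    refine submodule_eq_top_of_exact hex hρ S hSclosed (fun y => ?_) ?_
    · show Filter.Tendsto _ _ _
      simpa [hψ, hρj] using hφj y
    · refine hx.mono ?_
      have : Submodule.span ℝ (range x) ≤ S.map (ρ : Z →ₗ[ℝ] X) := by
        rw [Submodule.span_le]
        rintro _ ⟨i, rfl⟩
        refine ⟨σ (x i), ?_, hσ _⟩
        show Filter.Tendsto _ _ _
        refine squeeze_zero_norm' ?_ tendsto_one_div_add_atTop_nhds_zero_nat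
        filter_upwards [hg i] with n hn
        rw [hψ, hσ, Real.norm_eq_abs]
        exact hn.le
      intro f hf
      obtain ⟨z, hz, rfl⟩ := this hf
      exact ⟨z, hz, rfl⟩
  obtain ⟨P, hP⟩ := CZero.exists_operator ψ _ hψM fun z => by
    have : z ∈ S := hStop ▸ Submodule.mem_top
    exact this
  refine ⟨P, fun y => ?_⟩
  ext n
  rw [hP, hψ, hρj, map_zero, sub_zero, hφ]
  rfl

end Amalgamation

/-! ### Amalgamation in `C(K)` for `K` of finite height -/

/-- A decreasing sequence of closed sets with relatively discrete differences that starts with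
the whole space and reaches the empty set after `n` steps. -/
structure IsScatteredFiltration {K : Type*} [TopologicalSpace K] (A : ℕ → Set K) (n : ℕ) :
    Prop where
  zero : A 0 = Set.univ
  closed : ∀ m, IsClosed (A m)
  subset : ∀ m, A (m + 1) ⊆ A m
  acc : ∀ m, derivedSet (A m) ⊆ A (m + 1)
  empty : A n = ∅

theorem HasFiniteHeight.exists_filtration {K : Type*} [TopologicalSpace K]
    (h : HasFiniteHeight K) : ∃ n, IsScatteredFiltration
      (fun m : ℕ => iteratedDerivedSet (Set.univ : Set K) (m : Ordinal)) n := by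
  obtain ⟨n, hn⟩ := h
  have hcl := isClosed_iteratedDerivedSet (isClosed_univ (X := K))
  have hsucc : ∀ m : ℕ, iteratedDerivedSet (Set.univ : Set K) ((m + 1 : ℕ) : Ordinal) =
      derivedSet (iteratedDerivedSet (Set.univ : Set K) (m : Ordinal)) := fun m => by
    rw [Nat.cast_add, Nat.cast_one, iteratedDerivedSet_succ, (hcl _).relDerivedSet_eq]
  refine ⟨n, by simp, fun m => hcl _, fun m => ?_, fun m => (hsucc m).ge, hn⟩
  rw [hsucc]
  exact (isClosed_iff_derivedSet_subset _).1 (hcl _)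

theorem Nat.of_descending {P : ℕ → Prop} {n : ℕ} (hn : P n) (h : ∀ m, P (m + 1) → P m) : P 0 := by
  induction n with
  | zero => exact hn
  | succ n ih => exact ih (h n hn)

namespace IsScatteredFiltration

variable {K : Type*} [TopologicalSpace K] {A : ℕ → Set K} {n : ℕ}

theorem antitone (hA : IsScatteredFiltration A n) : Antitone A :=
  antitone_nat_of_succ_le hA.subset

theorem exists_level (hA : IsScatteredFiltration A n) (t : K) :
    ∃ m < n, t ∈ A m ∧ t ∉ A (m + 1) := by
  classical
  have hex : ∃ m, t ∉ A m := ⟨n, by simp [hA.empty]⟩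
  have h0 : Nat.find hex ≠ 0 := fun h => by
    have := Nat.find_spec hex
    rw [h, hA.zero] at this
    exact this trivial
  obtain ⟨m, hm⟩ := Nat.exists_eq_succ_of_ne_zero h0
  refine ⟨m, ?_, ?_, ?_⟩
  · have : Nat.find hex ≤ n := Nat.find_min' hex (by simp [hA.empty])
    omega
  · have := Nat.find_min hex (m := m) (by omega)
    simpa using this
  · have := Nat.find_spec hex
    rwa [hm] at this

theorem finite_of_disjoint [CompactSpace K] (hA : IsScatteredFiltration A n) {m : ℕ} {B : Set K}
    (hB : IsClosed B) (hBA : B ⊆ A m) (hd : ∀ x ∈ B, x ∉ A (m + 1)) : B.Finite := by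
  by_contra hinf
  obtain ⟨x, hx, hacc⟩ := Set.Infinite.exists_accPt_of_subset_isCompact hinf hB.isCompact
    subset_rfl
  exact hd x hx (hA.acc m (derivedSet_mono _ _ hBA hacc))

/-- Limit points of `A m` lie in `A (m + 1)`, so `t` is isolated in `A m`. -/
theorem isClosed_diff_singleton (hA : IsScatteredFiltration A n) {m : ℕ} {t : K}
    (ht : t ∉ A (m + 1)) : IsClosed (A m \ {t}) := by
  rw [isClosed_iff_derivedSet_subset]
  intro x hx
  have hx' := hA.acc m (derivedSet_mono _ _ sdiff_subset hx)
  refine ⟨hA.subset m hx', ?_⟩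
  rintro rfl
  exact ht hx'

/-- A family of functions that is triangular with respect to a filtration. -/
def IsTriangular (A : ℕ → Set K) (e : K → C(K, ℝ)) : Prop :=
  ∀ t, e t t = 1 ∧ ∀ m, t ∈ A m → t ∉ A (m + 1) → ∀ y ∈ A m, y ≠ t → e t y = 0

theorem exists_triangular [CompactSpace K] [T2Space K] (hA : IsScatteredFiltration A n) :
    ∃ e : K → C(K, ℝ), IsTriangular A e := by
  have : ∀ t, ∃ f : C(K, ℝ), f t = 1 ∧
      ∀ m, t ∈ A m → t ∉ A (m + 1) → ∀ y ∈ A m, y ≠ t → f y = 0 := by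
    intro t
    obtain ⟨m, -, htm, htm'⟩ := hA.exists_level t
    obtain ⟨f, hf0, hf1, -⟩ := exists_continuous_zero_one_of_isClosed
      (hA.isClosed_diff_singleton htm') (isClosed_singleton (x := t)) (by simp)
    refine ⟨f, hf1 rfl, fun m' h h' y hy hyt => ?_⟩
    have : m' = m := by
      rcases lt_trichotomy m' m with hlt | rfl | hlt
      · exact absurd (hA.antitone hlt htm) h'
      · rfl
      · exact absurd (hA.antitone hlt h) htm'
    subst this
    exact hf0 ⟨hy, hyt⟩
  choose e he using this
  exact ⟨e, he⟩

section Triangular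

variable {e : K → C(K, ℝ)}

theorem apply_eq_zero_of_mem_span (he : IsTriangular A e) {m : ℕ} {G : Set K}
    (hG : G ⊆ A m \ A (m + 1)) {u : C(K, ℝ)} (hu : u ∈ Submodule.span ℝ (e '' G)) {y : K}
    (hy : y ∈ A m) (hyG : y ∉ G) : u y = 0 := by
  induction hu using Submodule.span_induction with
  | mem u hu =>
    obtain ⟨t, ht, rfl⟩ := hu
    exact (he t).2 m (hG ht).1 (hG ht).2 y hy (fun h => hyG (h ▸ ht))
  | zero => rfl
  | add f g _ _ hf hg => simp [hf, hg]
  | smul a f _ hf => simp [hf]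

/-- On points of a single level, the functions `e t` form a dual basis to the evaluations. -/
theorem exists_mem_span_eq_on (he : IsTriangular A e) {m : ℕ} {G : Set K}
    (hG : G ⊆ A m \ A (m + 1)) (hGf : G.Finite) (v : K → ℝ) :
    ∃ u ∈ Submodule.span ℝ (e '' G), ∀ y ∈ G, u y = v y := by
  classical
  lift G to Finset K using hGf
  refine ⟨∑ t ∈ G, v t • e t, Submodule.sum_mem _ fun t ht => Submodule.smul_mem _ _
    (Submodule.subset_span ⟨t, ht, rfl⟩), fun y hy => ?_⟩
  simp only [ContinuousMap.coe_sum, ContinuousMap.coe_smul, Finset.sum_apply, Pi.smul_apply,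
    smul_eq_mul]
  rw [Finset.sum_eq_single y]
  · rw [(he y).1, mul_one]
  · intro t ht hty
    rw [(he t).2 m (hG ht).1 (hG ht).2 y (hG hy).1 hty.symm, mul_zero]
  · exact fun h => absurd hy h

theorem eq_zero_of_mem_span_level (he : IsTriangular A e) {m : ℕ} {G : Set K}
    (hG : G ⊆ A m \ A (m + 1)) (hGf : G.Finite) {u : C(K, ℝ)}
    (hu : u ∈ Submodule.span ℝ (e '' G)) (h0 : ∀ y ∈ G, u y = 0) : u = 0 := by
  classical
  lift G to Finset K using hGf
  have : u = ∑ t ∈ G, u t • e t := by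
    clear h0
    induction hu using Submodule.span_induction with
    | mem u hu =>
      obtain ⟨t, ht, rfl⟩ := hu
      rw [Finset.sum_eq_single t]
      · rw [(he t).1, one_smul]
      · intro s hs hst
        rw [(he t).2 m (hG ht).1 (hG ht).2 s (hG hs).1 hst, zero_smul]
      · exact fun h => absurd ht h
    | zero => simp
    | add f g _ _ hf hg =>
      simp only [ContinuousMap.add_apply, add_smul, Finset.sum_add_distrib]
      rw [← hf, ← hg]
    | smul a f _ hf =>
      simp only [ContinuousMap.smul_apply, smul_assoc, ← Finset.smul_sum]
      rw [← hf]
  rw [this]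
  exact Finset.sum_eq_zero fun t ht => by rw [h0 t ht, zero_smul]

theorem exists_decomposition (hA : IsScatteredFiltration A n) {m : ℕ} {F : Set K} {f : C(K, ℝ)}
    (hf : f ∈ Submodule.span ℝ (e '' (F ∩ A m))) :
    ∃ f' ∈ Submodule.span ℝ (e '' (F ∩ A (m + 1))),
      ∃ u ∈ Submodule.span ℝ (e '' (F ∩ (A m \ A (m + 1)))), f = f' + u := by
  have : F ∩ A m = F ∩ A (m + 1) ∪ F ∩ (A m \ A (m + 1)) := by
    rw [← inter_union_distrib_left, union_sdiff_cancel (hA.subset m)]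
  rw [this, image_union, Submodule.span_union] at hf
  obtain ⟨f', hf', u, hu, rfl⟩ := Submodule.mem_sup.1 hf
  exact ⟨f', hf', u, hu, rfl⟩

/-- By triangularity the level-`m` part vanishes on `A (m + 1)`, so the deeper part is killed first.
In `finite_uncontrolled` this excludes a nonzero function vanishing on `A (m + 1)`. -/
theorem eq_zero_of_mem_span (hA : IsScatteredFiltration A n) (he : IsTriangular A e)
    {F : Set K} (hF : F.Finite) (m : ℕ) (hm : m ≤ n) {f : C(K, ℝ)}
    (hf : f ∈ Submodule.span ℝ (e '' (F ∩ A m))) (h0 : ∀ x ∈ A m, f x = 0) : f = 0 := by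
  induction hm using Nat.decreasingInduction generalizing f with
  | self => simpa [hA.empty] using hf
  | of_succ m hm ih =>
    obtain ⟨f', hf', u, hu, rfl⟩ := hA.exists_decomposition hf
    have hu0 : ∀ x ∈ A (m + 1), u x = 0 := fun x hx =>
      apply_eq_zero_of_mem_span he inter_subset_right hu (hA.subset m hx) fun h => h.2.2 hx
    have hf'0 : f' = 0 := ih hf' fun x hx => by
      have := h0 x (hA.subset m hx)
      simpa [hu0 x hx] using this
    subst hf'0
    rw [zero_add] at h0 ⊢
    exact eq_zero_of_mem_span_level he inter_subset_right (hF.inter_of_left _) hu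
      fun y hy => h0 y hy.2.1

/-- Functions in the span of the part of `F` in `A (k + 1)` are controlled off `F` by their
values on `A (k + 1)`, for `m ≤ k`. -/
def IsGood (A : ℕ → Set K) (e : K → C(K, ℝ)) (m : ℕ) (F : Set K) : Prop :=
  ∀ k, m ≤ k → ∀ x ∈ A k, x ∉ F → ∀ f ∈ Submodule.span ℝ (e '' (F ∩ A (k + 1))), ∀ M : ℝ, 0 ≤ M →
    (∀ y ∈ A (k + 1), |f y| ≤ M) → |f x| ≤ 2 * M

/-- Descending induction on the level. The `h'` found on `A (m + 1)` is corrected at the common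
points of `F₁` and `F₂` at level `m`, where it is made equal to f; at the other points of the level,
goodness of `F₁` or `F₂` carries the bounds over from `A (m + 1)`. -/
theorem exists_amalgamation (hA : IsScatteredFiltration A n) (he : IsTriangular A e) :
    ∃ C : ℝ, 0 ≤ C ∧ ∀ F₁ F₂ : Set K, F₁.Finite → F₂.Finite → IsGood A e 0 F₁ → IsGood A e 0 F₂ →
      ∀ f ∈ Submodule.span ℝ (e '' (F₁ ∩ A 0)), ∀ g ∈ Submodule.span ℝ (e '' (F₂ ∩ A 0)),
        ∃ h ∈ Submodule.span ℝ (e '' (F₁ ∩ A 0)) ⊓ Submodule.span ℝ (e '' (F₂ ∩ A 0)),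
          ∀ M : ℝ, 0 ≤ M → (∀ x ∈ A 0, |f x + g x| ≤ M) → ∀ x ∈ A 0, |f x - h x| ≤ C * M := by
  refine Nat.of_descending (n := n) (P := fun m => ∃ C : ℝ, 0 ≤ C ∧ ∀ F₁ F₂ : Set K, F₁.Finite →
    F₂.Finite → IsGood A e 0 F₁ → IsGood A e 0 F₂ →
      ∀ f ∈ Submodule.span ℝ (e '' (F₁ ∩ A m)), ∀ g ∈ Submodule.span ℝ (e '' (F₂ ∩ A m)),
        ∃ h ∈ Submodule.span ℝ (e '' (F₁ ∩ A m)) ⊓ Submodule.span ℝ (e '' (F₂ ∩ A m)),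
          ∀ M : ℝ, 0 ≤ M → (∀ x ∈ A m, |f x + g x| ≤ M) → ∀ x ∈ A m, |f x - h x| ≤ C * M)
    ⟨0, le_rfl, fun F₁ F₂ _ _ _ _ f _ g _ => ⟨0, Submodule.zero_mem _, fun M _ _ x hx => by
      simp [hA.empty] at hx⟩⟩ ?_
  rintro m ⟨C, hC, ih⟩
  refine ⟨2 * C + 3, by positivity, fun F₁ F₂ hF₁ hF₂ h₁ h₂ f hf g hg => ?_⟩
  obtain ⟨f', hf', u, hu, rfl⟩ := hA.exists_decomposition hf
  obtain ⟨g', hg', w, hw, rfl⟩ := hA.exists_decomposition hg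
  obtain ⟨h', hh', hfh⟩ := ih F₁ F₂ hF₁ hF₂ h₁ h₂ f' hf' g' hg'
  have hG : F₁ ∩ F₂ ∩ (A m \ A (m + 1)) ⊆ A m \ A (m + 1) := inter_subset_right
  obtain ⟨v, hv, hvG⟩ := exists_mem_span_eq_on he hG
    ((hF₁.inter_of_left _).inter_of_left _) (fun y => (f' + u) y - h' y)
  have hzero : ∀ {F : Set K} {u : C(K, ℝ)}, u ∈ Submodule.span ℝ (e '' (F ∩ (A m \ A (m + 1)))) →
      ∀ y ∈ A m, (y ∉ F ∨ y ∈ A (m + 1)) → u y = 0 := fun hu y hy h =>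
    apply_eq_zero_of_mem_span he inter_subset_right hu hy
      fun h' => h.elim (fun h => h h'.1) fun h => h'.2.2 h
  have hsub : ∀ F : Set K, Submodule.span ℝ (e '' (F ∩ A (m + 1))) ≤
      Submodule.span ℝ (e '' (F ∩ A m)) := fun F =>
    Submodule.span_mono (image_mono (inter_subset_inter_right _ (hA.subset m)))
  refine ⟨h' + v, ⟨Submodule.add_mem _ (hsub _ hh'.1) (Submodule.span_mono (image_mono ?_) hv),
    Submodule.add_mem _ (hsub _ hh'.2) (Submodule.span_mono (image_mono ?_) hv)⟩,
    fun M hM hfg x hx => ?_⟩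
  · exact fun y hy => ⟨hy.1.1, hy.2.1⟩
  · exact fun y hy => ⟨hy.1.2, hy.2.1⟩
  have hfg' : ∀ y ∈ A (m + 1), |f' y + g' y| ≤ M := fun y hy => by
    have := hfg y (hA.subset m hy)
    simpa [hzero hu y (hA.subset m hy) (Or.inr hy),
      hzero hw y (hA.subset m hy) (Or.inr hy)] using this
  have hfh' := hfh M hM hfg'
  by_cases hx1 : x ∈ F₁ ∧ x ∉ A (m + 1)
  · by_cases hx2 : x ∈ F₂
    · rw [ContinuousMap.add_apply h' v, hvG x ⟨⟨hx1.1, hx2⟩, hx, hx1.2⟩]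
      simp only [add_sub_cancel, sub_self, abs_zero]
      positivity
    · have hv0 := hzero hv x hx (Or.inl fun h => hx2 h.2)
      have hw0 := hzero hw x hx (Or.inl hx2)
      -- Here x ∉ F₂, so goodness of `F₂` bounds h' + g' by 2(C + 1)M. With the bound M on f + g
      -- this gives the constant 2C + 3.
      have h3 := h₂ m (Nat.zero_le _) x hx hx2 (h' + g') (Submodule.add_mem _ hh'.2 hg')
        ((C + 1) * M) (by positivity) fun y hy => by
          have : (h' + g') y = (f' y + g' y) - (f' y - h' y) := by
            rw [ContinuousMap.add_apply]; ring
          rw [this]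
          refine (abs_sub _ _).trans ?_
          have := hfh' y hy
          have := hfg' y hy
          linarith
      have h4 := hfg x hx
      simp only [ContinuousMap.add_apply, hv0, hw0, add_zero] at h3 h4 ⊢
      have : f' x + u x - h' x = (f' x + u x + g' x) - (h' x + g' x) := by ring
      rw [this]
      refine (abs_sub _ _).trans ?_
      linarith
  · have hu0 := hzero hu x hx (by tauto)
    have hv0 := hzero hv x hx (by
      rw [mem_inter_iff]; tauto)
    simp only [ContinuousMap.add_apply, hu0, hv0, add_zero]
    by_cases hxA : x ∈ A (m + 1)
    · refine (hfh' x hxA).trans ?_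
      nlinarith
    · have := h₁ m (Nat.zero_le _) x hx (by tauto) (f' - h') (Submodule.sub_mem _ hf' hh'.1)
        (C * M) (by positivity) hfh'
      rw [ContinuousMap.sub_apply] at this
      linarith

/-- The exceptional points are the projection of a compact set of pairs (unit vector, point). This
projection is closed and misses `A (m + 1)`, hence is finite. -/
theorem finite_uncontrolled [CompactSpace K] (hA : IsScatteredFiltration A n)
    (he : IsTriangular A e) {F : Set K} (hF : F.Finite) {m : ℕ} (hm : m < n)
    (hFA : F ⊆ A (m + 1)) :
    ∃ B : Set K, B.Finite ∧ B ⊆ A m \ A (m + 1) ∧ ∀ x ∈ A m, x ∉ B →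
      ∀ f ∈ Submodule.span ℝ (e '' F), ∀ M : ℝ, 0 ≤ M → (∀ y ∈ A (m + 1), |f y| ≤ M) →
        |f x| ≤ 2 * M := by
  let E := Submodule.span ℝ (e '' F)
  have : FiniteDimensional ℝ E := FiniteDimensional.span_of_finite ℝ (hF.image e)
  have : ProperSpace E := FiniteDimensional.proper ℝ E
  -- The factor must exceed 1: then a pair with its point in `A (m + 1)` has a function vanishing on
  -- `A (m + 1)`, hence zero.
  let Q : Set (E × K) := {p | ∀ y ∈ A (m + 1), 2 * |(p.1 : C(K, ℝ)) y| ≤ |(p.1 : C(K, ℝ)) p.2|}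
  have hQ : IsClosed Q := by
    have : Q = ⋂ y ∈ A (m + 1),
        {p : E × K | 2 * |(p.1 : C(K, ℝ)) y| ≤ |(p.1 : C(K, ℝ)) p.2|} := by
      ext p; simp [Q]
    rw [this]
    refine isClosed_biInter fun y _ => isClosed_le ?_ ?_ <;> fun_prop
  have hS := ((isCompact_sphere (0 : E) 1).prod (hA.closed m).isCompact).inter_right hQ
  have hB := hS.image continuous_snd
  have hBd : ∀ x ∈ Prod.snd '' (Metric.sphere (0 : E) 1 ×ˢ A m ∩ Q), x ∉ A (m + 1) := by
    rintro _ ⟨⟨f, x⟩, ⟨⟨hf, -⟩, hq⟩, rfl⟩ hx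
    have h1 := hq x hx
    have h2 : |(f : C(K, ℝ)) x| = 0 := le_antisymm (by simp only at h1 ⊢; linarith) (abs_nonneg _)
    have : (f : C(K, ℝ)) = 0 := by
      refine hA.eq_zero_of_mem_span he hF (m + 1) hm (f := f) ?_ fun y hy => ?_
      · rw [inter_eq_left.2 hFA]; exact f.2
      · have h3 := hq y hy
        simp only [h2] at h3
        exact abs_eq_zero.1 (le_antisymm (by linarith) (abs_nonneg _))
    have hf0 : f = 0 := Subtype.ext this
    subst hf0
    simp at hf
  have hBsub : Prod.snd '' (Metric.sphere (0 : E) 1 ×ˢ A m ∩ Q) ⊆ A m := by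
    rintro _ ⟨p, ⟨⟨-, hp⟩, -⟩, rfl⟩
    exact hp
  refine ⟨_, ?_, fun x hx => ⟨hBsub hx, hBd x hx⟩, fun x hx hxB f hf M hM hfM => ?_⟩
  · by_contra hinf
    obtain ⟨x, hx, hacc⟩ := Set.Infinite.exists_accPt_of_subset_isCompact hinf hB subset_rfl
    exact hBd x hx (hA.acc m (derivedSet_mono _ _ hBsub hacc))
  · rcases eq_or_ne f 0 with rfl | hf0
    · simpa using hM
    by_contra hlt
    rw [not_le] at hlt
    have hpos := norm_pos_iff.2 hf0
    refine hxB ⟨(‖f‖⁻¹ • ⟨f, hf⟩, x), ⟨⟨?_, hx⟩, fun y hy => ?_⟩, rfl⟩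
    · rw [mem_sphere_zero_iff_norm]
      change ‖‖f‖⁻¹ • f‖ = 1
      rw [norm_smul, norm_inv, norm_norm]
      exact inv_mul_cancel₀ hpos.ne'
    · have := hfM y hy
      have hinv := inv_pos.2 hpos
      simp only [Submodule.coe_smul, ContinuousMap.smul_apply, smul_eq_mul, abs_mul,
        abs_of_pos hinv]
      have h5 : 2 * |f y| ≤ |f x| := by linarith
      nlinarith

/-- Exceptional points are added from the last level down to level 0. Adding points at level `m`
does not alter the part of `F` in deeper levels, so earlier control persists. -/
theorem exists_good [CompactSpace K] (hA : IsScatteredFiltration A n) (he : IsTriangular A e)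
    {F₀ : Set K} (hF₀ : F₀.Finite) : ∃ F, F₀ ⊆ F ∧ F.Finite ∧ IsGood A e 0 F := by
  suffices H : ∀ m ≤ n, ∃ F : Set K, F.Finite ∧ F₀ ∩ A m ⊆ F ∧ F ⊆ A m ∧ IsGood A e m F by
    obtain ⟨F, hF, hsub, -, hgood⟩ := H 0 (Nat.zero_le _)
    exact ⟨F, by simpa [hA.zero] using hsub, hF, hgood⟩
  intro m hm
  induction hm using Nat.decreasingInduction with
  | self =>
    refine ⟨∅, finite_empty, by simp [hA.empty], empty_subset _, fun k hk x hx => ?_⟩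
    have := hA.antitone hk hx
    simp [hA.empty] at this
  | of_succ m hm ih =>
    obtain ⟨F, hF, hsub, hFA, hgood⟩ := ih
    obtain ⟨B, hBf, hBA, hB⟩ := hA.finite_uncontrolled he hF hm hFA
    have hinter : ∀ k, m ≤ k →
        (F ∪ (B ∪ F₀ ∩ (A m \ A (m + 1)))) ∩ A (k + 1) = F ∩ A (k + 1) := by
      intro k hk
      ext x
      refine ⟨?_, fun h => ⟨Or.inl h.1, h.2⟩⟩
      rintro ⟨h | h | h, hx⟩
      · exact ⟨h, hx⟩
      · exact absurd (hA.antitone (by omega) hx) (hBA h).2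
      · exact absurd (hA.antitone (by omega) hx) h.2.2
    refine ⟨F ∪ (B ∪ F₀ ∩ (A m \ A (m + 1))), hF.union (hBf.union (hF₀.inter_of_left _)), ?_, ?_, ?_⟩
    · intro x hx
      by_cases h : x ∈ A (m + 1)
      · exact Or.inl (hsub ⟨hx.1, h⟩)
      · exact Or.inr (Or.inr ⟨hx.1, hx.2, h⟩)
    · refine union_subset (hFA.trans (hA.subset m)) (union_subset (hBA.trans sdiff_subset) ?_)
      exact fun x hx => hx.2.1
    · intro k hk x hx hxF f hf M hM hfM
      rw [hinter k hk] at hf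
      rcases hk.eq_or_lt with rfl | hlt
      · rw [inter_eq_left.2 hFA] at hf
        exact hB x hx (fun h => hxF (Or.inr (Or.inl h))) f hf M hM hfM
      · exact hgood k hlt x hx (fun h => hxF (Or.inl h)) f hf M hM hfM

theorem hasAmalgamation [CompactSpace K] (hA : IsScatteredFiltration A n)
    (he : IsTriangular A e) : HasAmalgamation e := by
  obtain ⟨C, hC, h⟩ := hA.exists_amalgamation he
  refine ⟨{F | IsGood A e 0 F}, C, hC, fun F₀ => ?_, fun F₁ h₁ F₂ h₂ f hf g hg => ?_⟩
  · obtain ⟨F, hsub, hF, hgood⟩ := hA.exists_good he F₀.finite_toSet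
    lift F to Finset K using hF
    exact ⟨F, hgood, by simpa using hsub⟩
  · have := h F₁ F₂ F₁.finite_toSet F₂.finite_toSet h₁ h₂ f (by simpa [hA.zero] using hf) g
      (by simpa [hA.zero] using hg)
    simp only [hA.zero, inter_univ] at this
    obtain ⟨h, hh, hb⟩ := this
    refine ⟨h, hh, (ContinuousMap.norm_le _ (by positivity)).2 fun x => ?_⟩
    exact hb _ (norm_nonneg _) (fun y _ => (f + g).norm_coe_le_norm y) x trivial

/-- An approximation valid on `A (m + 1)` fails at only finitely many points of `A m`. It is made
exact there by functions that vanish on the rest of `A m`. -/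
theorem dense_span [CompactSpace K] (hA : IsScatteredFiltration A n) (he : IsTriangular A e) :
    Dense (Submodule.span ℝ (range e) : Set C(K, ℝ)) := by
  intro f
  rw [Metric.mem_closure_iff]
  intro ε hε
  have H : ∃ s ∈ Submodule.span ℝ (range e), ∀ x ∈ A 0, |f x - s x| < ε := by
    refine Nat.of_descending (n := n)
      (P := fun m => ∃ s ∈ Submodule.span ℝ (range e), ∀ x ∈ A m, |f x - s x| < ε)
      ⟨0, Submodule.zero_mem _, by simp [hA.empty]⟩ ?_
    rintro m ⟨s, hs, hfs⟩
    let G := A m ∩ {x | ε ≤ |f x - s x|}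
    have hGcl : IsClosed G := (hA.closed m).inter (isClosed_le continuous_const (by fun_prop))
    have hGd : ∀ x ∈ G, x ∉ A (m + 1) := fun x hx hx' => not_lt.2 hx.2 (hfs x hx')
    have hGsub : G ⊆ A m \ A (m + 1) := fun x hx => ⟨hx.1, hGd x hx⟩
    obtain ⟨u, hu, hueq⟩ := exists_mem_span_eq_on he hGsub
      (hA.finite_of_disjoint hGcl inter_subset_left hGd) (fun x => f x - s x)
    refine ⟨s + u, Submodule.add_mem _ hs (Submodule.span_mono (image_subset_range _ _) hu),
      fun x hx => ?_⟩
    rw [ContinuousMap.add_apply]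
    by_cases hxG : x ∈ G
    · rw [hueq x hxG]; simpa using hε
    · rw [apply_eq_zero_of_mem_span he hGsub hu hx hxG, add_zero]
      by_contra hge
      exact hxG ⟨hx, not_lt.1 hge⟩
  obtain ⟨s, hs, hfs⟩ := H
  refine ⟨s, hs, ?_⟩
  rw [ContinuousMap.dist_lt_iff hε]
  intro x
  rw [Real.dist_eq]
  exact hfs x (by simp [hA.zero])

end Triangular

end IsScatteredFiltration

/-! ### Extension of `C(K)`-valued operators -/

section Oscillation

variable {K : Type*} [TopologicalSpace K]

/-- The characteristic function of a clopen set. -/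
noncomputable def clopenIndicator {V : Set K} (hV : IsClopen V) : C(K, ℝ) where
  toFun := V.indicator 1
  continuous_toFun := continuous_indicator (by simp [hV.frontier_eq]) continuous_one.continuousOn

theorem clopenIndicator_of_mem {V : Set K} (hV : IsClopen V) {x : K} (hx : x ∈ V) :
    clopenIndicator hV x = 1 := indicator_of_mem hx _

theorem clopenIndicator_of_notMem {V : Set K} (hV : IsClopen V) {x : K} (hx : x ∉ V) :
    clopenIndicator hV x = 0 := indicator_of_notMem hx _

/-- The sequence `g` of functions is uniformly `ℓ₁`-close on `V` to a sequence of
continuous functions. -/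
def IsNearContinuousOn (g : ℕ → K → ℝ) (c : ℝ) (V : Set K) : Prop :=
  ∃ f : ℕ → C(K, ℝ), ∀ x ∈ V, ∀ N, ∑ n ∈ Finset.range N, |g n x - f n x| ≤ c

theorem IsNearContinuousOn.mono {g : ℕ → K → ℝ} {c c' : ℝ} {V V' : Set K}
    (h : IsNearContinuousOn g c V) (hc : c ≤ c') (hV : V' ⊆ V) : IsNearContinuousOn g c' V' := by
  obtain ⟨f, hf⟩ := h
  exact ⟨f, fun x hx N => (hf x (hV hx) N).trans hc⟩

theorem IsNearContinuousOn.union {g : ℕ → K → ℝ} {c : ℝ} {V V' : Set K}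
    (h : IsNearContinuousOn g c V) (h' : IsNearContinuousOn g c V') (hV : IsClopen V) :
    IsNearContinuousOn g c (V ∪ V') := by
  obtain ⟨f, hf⟩ := h
  obtain ⟨f', hf'⟩ := h'
  refine ⟨fun n => f' n + clopenIndicator hV * (f n - f' n), fun x hx N => ?_⟩
  by_cases hxV : x ∈ V
  · simpa [clopenIndicator_of_mem hV hxV] using hf x hxV N
  · simpa [clopenIndicator_of_notMem hV hxV] using hf' x (hx.resolve_left hxV) N

/-- Gluing over clopen sets does not increase the constant, so compactness suffices. -/
theorem isNearContinuousOn_of_local {g : ℕ → K → ℝ} {c : ℝ} {U : Set K} (hU : IsCompact U)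
    (h : ∀ x ∈ U, ∃ V, IsClopen V ∧ x ∈ V ∧ IsNearContinuousOn g c V) :
    IsNearContinuousOn g c U := by
  have : ∃ V, IsClopen V ∧ U ⊆ V ∧ IsNearContinuousOn g c V := by
    refine hU.induction_on (p := fun s => ∃ V, IsClopen V ∧ s ⊆ V ∧ IsNearContinuousOn g c V)
      ⟨∅, isClopen_empty, subset_rfl, fun _ => 0, fun x hx => absurd hx (by simp)⟩ ?_ ?_ ?_
    · rintro s t hst ⟨V, hV, htV, hg⟩
      exact ⟨V, hV, hst.trans htV, hg⟩
    · rintro s t ⟨V, hV, hsV, hg⟩ ⟨V', hV', htV', hg'⟩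
      exact ⟨V ∪ V', hV.union hV', union_subset_union hsV htV', hg.union hg' hV⟩
    · intro x hx
      obtain ⟨V, hV, hxV, hg⟩ := h x hx
      exact ⟨V, mem_nhdsWithin_of_mem_nhds (hV.isOpen.mem_nhds hxV), V, hV, subset_rfl, hg⟩
  obtain ⟨V, -, hUV, hg⟩ := this
  exact hg.mono le_rfl hUV

variable [CompactSpace K] [T2Space K] [TotallyDisconnectedSpace K]

/-- The gluing step: near a point `x` such that the sequence is approximable on all clopen sets
that avoid `x`. -/
theorem isNearContinuousOn_of_punctured {g : ℕ → K → ℝ} {c M : ℝ} (hc : 0 ≤ c) {V : Set K} {x : K}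
    (hV : IsClopen V)
    (hosc : ∀ N, ∀ᶠ y in 𝓝 x, ∑ n ∈ Finset.range N, |g n y - g n x| ≤ M)
    (h : ∀ D ⊆ V, IsClopen D → x ∉ D → IsNearContinuousOn g c D) :
    IsNearContinuousOn g (c + M) V := by
  have hW : ∀ N, ∃ W : Set K, IsClopen W ∧ x ∈ W ∧
      ∀ y ∈ W, ∑ n ∈ Finset.range (N + 1), |g n y - g n x| ≤ M := fun N => by
    obtain ⟨O, hO, hOo, hxO⟩ := mem_nhds_iff.1 (hosc (N + 1))
    obtain ⟨W, hWc, hxW, hWO⟩ := compact_exists_isClopen_in_isOpen hOo hxO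
    exact ⟨W, hWc, hxW, fun y hy => hO (hWO hy)⟩
  choose W hWc hxW hWM using hW
  let U : ℕ → Set K := fun N => V ∩ ⋂ k ∈ Finset.range N, W k
  have hUc : ∀ N, IsClopen (U N) := fun N =>
    hV.inter (isClopen_biInter_finset fun k _ => hWc k)
  have hU0 : U 0 = V := by simp [U]
  have hUanti : Antitone U := antitone_nat_of_succ_le fun N =>
    inter_subset_inter_right _ (biInter_subset_biInter_left (by
      intro k hk
      exact Finset.mem_coe.2 (Finset.mem_range.2 ((Finset.mem_range.1 hk).trans (Nat.lt_succ_self N)))))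
  have hM0 : 0 ≤ M := by simpa using (hosc 0).self_of_nhds
  have hUM : ∀ N, ∀ y ∈ U N, ∑ n ∈ Finset.range N, |g n y - g n x| ≤ M := by
    intro N y hy
    cases N with
    | zero => simpa using hM0
    | succ N => exact hWM N y (mem_iInter₂.1 hy.2 N (Finset.self_mem_range_succ N))
  -- On the ring `D k` the first k functions are replaced by their values at `x`, at total cost M,
  -- and the others by the approximants on `D k`, at total cost c. Each `F n` thus involves only
  -- finitely many rings and is continuous.
  let D : ℕ → Set K := fun k => U k \ U (k + 1)
  have hDc : ∀ k, IsClopen (D k) := fun k => (hUc k).diff (hUc (k + 1))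
  have hDsub : ∀ k, D k ⊆ V := fun k y hy => hy.1.1
  by_cases hxV : x ∈ V
  swap
  · exact (h V subset_rfl hV hxV).mono (by linarith) subset_rfl
  have hxD : ∀ k, x ∉ D k := fun k hx =>
    hx.2 ⟨hxV, mem_iInter₂.2 fun i _ => hxW i⟩
  choose f hf using fun k => h (D k) (hDsub k) (hDc k) (hxD k)
  have hDuniq : ∀ {k l y}, y ∈ D k → y ∈ D l → k = l := by
    intro k l y hk hl
    rcases lt_trichotomy k l with hlt | rfl | hlt
    · exact absurd (hUanti hlt hl.1) hk.2
    · rfl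
    · exact absurd (hUanti hlt hk.1) hl.2
  let F : ℕ → C(K, ℝ) := fun n => ContinuousMap.const K (g n x) +
    ∑ k ∈ Finset.range (n + 1), clopenIndicator (hDc k) * (f k n - ContinuousMap.const K (g n x))
  have hFeq : ∀ n y, F n y = g n x +
      ∑ k ∈ Finset.range (n + 1), clopenIndicator (hDc k) y * (f k n y - g n x) := fun n y => by
    simp [F]
  have hF1 : ∀ n y, (∀ k ≤ n, y ∉ D k) → F n y = g n x := by
    intro n y hy
    rw [hFeq, Finset.sum_eq_zero, add_zero]
    intro k hk
    rw [clopenIndicator_of_notMem _ (hy k (by simpa [Nat.lt_succ_iff] using hk)), zero_mul]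
  have hF2 : ∀ n y k, k ≤ n → y ∈ D k → F n y = f k n y := by
    intro n y k hk hy
    rw [hFeq, Finset.sum_eq_single k]
    · rw [clopenIndicator_of_mem _ hy]; ring
    · intro l _ hlk
      rw [clopenIndicator_of_notMem _ fun hl => hlk (hDuniq hl hy), zero_mul]
    · intro hk'
      exact absurd (Finset.mem_range.2 (Nat.lt_succ_of_le hk)) hk'
  refine ⟨F, fun y hy N => ?_⟩
  by_cases hyD : ∃ k, y ∈ D k
  · obtain ⟨k, hk⟩ := hyD
    have hterm : ∀ n, |g n y - F n y| ≤
        |g n y - f k n y| + if n < k then |g n y - g n x| else 0 := by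
      intro n
      split_ifs with hn
      · rw [hF1 n y fun l hl hyl => by have := hDuniq hyl hk; omega]
        linarith [abs_nonneg (g n y - f k n y)]
      · rw [hF2 n y k (not_lt.1 hn) hk, add_zero]
    refine (Finset.sum_le_sum fun n _ => hterm n).trans ?_
    rw [Finset.sum_add_distrib]
    refine add_le_add (hf k y hk N) (le_trans ?_ (hUM k y hk.1))
    rw [← Finset.sum_filter]
    refine Finset.sum_le_sum_of_subset_of_nonneg ?_ fun _ _ _ => abs_nonneg _
    intro n hn
    simpa using (Finset.mem_filter.1 hn).2
  · push Not at hyD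
    have hyU : ∀ N, y ∈ U N := fun N => by
      induction N with
      | zero => rwa [hU0]
      | succ N ih => by_contra hn; exact hyD N ⟨ih, hn⟩
    rw [Finset.sum_congr rfl fun n _ => by rw [hF1 n y fun k _ => hyD k]]
    linarith [hUM N y (hyU N)]

/-- Induction over clopen sets that miss `A m`. A point outside `A (m + 1)` has a clopen
neighbourhood meeting `A m` at most in that point, so the gluing step applies and each level costs
one more M. -/
theorem IsScatteredFiltration.isNearContinuousOn {A : ℕ → Set K} {n : ℕ}
    (hA : IsScatteredFiltration A n) {g : ℕ → K → ℝ} {M : ℝ}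
    (hosc : ∀ N x, ∀ᶠ y in 𝓝 x, ∑ n ∈ Finset.range N, |g n y - g n x| ≤ M) :
    ∃ c, 0 ≤ c ∧ IsNearContinuousOn g c Set.univ := by
  rcases isEmpty_or_nonempty K with hK | ⟨⟨x₀⟩⟩
  · exact ⟨0, le_rfl, fun _ => 0, fun x => isEmptyElim x⟩
  have hM : 0 ≤ M := by simpa using (hosc 0 x₀).self_of_nhds
  suffices H : ∀ m : ℕ, ∀ U : Set K, IsClopen U → U ∩ A m = ∅ → IsNearContinuousOn g (m * M) U from
    ⟨n * M, by positivity, H n _ isClopen_univ (by simp [hA.empty])⟩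
  intro m
  induction m with
  | zero =>
    intro U _ hU
    rw [hA.zero, inter_univ] at hU
    exact ⟨fun _ => 0, fun x hx => absurd hx (by simp [hU])⟩
  | succ m ih =>
    intro U hU hUA
    refine isNearContinuousOn_of_local hU.isClosed.isCompact fun x hx => ?_
    have hxA : x ∉ A (m + 1) := fun h => by
      have : x ∈ U ∩ A (m + 1) := ⟨hx, h⟩
      simp [hUA] at this
    obtain ⟨V, hV, hxV, hVsub⟩ := compact_exists_isClopen_in_isOpen
      (hU.isOpen.inter (hA.isClosed_diff_singleton hxA).isOpen_compl) ⟨hx, fun h => h.2 rfl⟩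
    refine ⟨V, hV, hxV, ?_⟩
    have := isNearContinuousOn_of_punctured (c := m * M) (by positivity) hV (fun N => hosc N x)
      (fun D hDV hD hxD => ih D hD (by
        rw [eq_empty_iff_forall_notMem]
        rintro y ⟨hyD, hyA⟩
        exact (hVsub (hDV hyD)).2 ⟨hyA, fun hyx => hxD (hyx ▸ hyD)⟩))
    refine this.mono (le_of_eq ?_) subset_rfl
    push_cast
    ring

end Oscillation

section Extension

variable {K : Type*} [TopologicalSpace K] {Y : Type*} {Z : Type*}
  [NormedAddCommGroup Y] [NormedSpace ℝ Y] [NormedAddCommGroup Z] [NormedSpace ℝ Z]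

/-- A signed sum of unit vectors has norm at most 1 in c₀, so it has a lift of bounded norm. The
same signed sum of the `w n` differs from this lift by an element of `Y`, on which `φ` varies
continuously with the point. Finitely many sign patterns recover the sum of absolute values. -/
theorem eventually_sum_abs_sub_le [CompleteSpace Z] {j : Y →L[ℝ] Z} {ρ : Z →L[ℝ] C₀(ℕ, ℝ)}
    (hex : Function.Exact j ρ) (hρ : Function.Surjective ρ) (T : Y →L[ℝ] C(K, ℝ))
    {φ : K → Z →L[ℝ] ℝ} (hφ : ∀ x y, φ x (j y) = T y x) {M : ℝ} (hM0 : 0 ≤ M)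
    (hM : ∀ x z, |φ x z| ≤ M * ‖z‖) {w : ℕ → Z} (hw : ∀ n, ρ (w n) = CZero.single n) :
    ∃ C, ∀ N x, ∀ᶠ y in 𝓝 x, ∑ n ∈ Finset.range N, |φ y (w n) - φ x (w n)| ≤ C := by
  classical
  obtain ⟨C₂, hC₂, hlift⟩ := ρ.exists_preimage_norm_le hρ
  refine ⟨2 * (M * C₂) + 1, fun N x => ?_⟩
  let ε : Finset ℕ → ℕ → ℝ := fun s n => if n ∈ s then 1 else -1
  have hs : ∀ s : Finset ℕ, ∀ᶠ y in 𝓝 x,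
      ∑ n ∈ Finset.range N, ε s n * (φ y (w n) - φ x (w n)) ≤ 2 * (M * C₂) + 1 := by
    intro s
    set a : C₀(ℕ, ℝ) := ∑ n ∈ Finset.range N, ε s n • CZero.single n with ha
    have ha1 : ‖a‖ ≤ 1 := by
      refine CZero.norm_le zero_le_one fun n => ?_
      rw [ha, CZero.sum_single_apply]
      simp only [ε]
      split_ifs <;> simp
    obtain ⟨z, hz, hzn⟩ := hlift a
    have hzM : ∀ x, |φ x z| ≤ M * C₂ := fun x =>
      (hM x z).trans (mul_le_mul_of_nonneg_left
        (hzn.trans (mul_le_of_le_one_right hC₂.le ha1)) hM0)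
    obtain ⟨y₀, hy₀⟩ := (hex ((∑ n ∈ Finset.range N, ε s n • w n) - z)).1 (by
      simp [hz, ha, hw])
    have hkey : ∀ y, ∑ n ∈ Finset.range N, ε s n * φ y (w n) = T y₀ y + φ y z := fun y => by
      rw [← hφ, hy₀]
      simp
    have hcont : ∀ᶠ y in 𝓝 x, |T y₀ y - T y₀ x| < 1 := by
      have := (T y₀).continuous.continuousAt.eventually (Metric.ball_mem_nhds (T y₀ x) one_pos)
      simpa [Real.dist_eq] using this
    filter_upwards [hcont] with y hy
    simp only [mul_sub, Finset.sum_sub_distrib, hkey]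
    have h1 := abs_le.1 (hzM x)
    have h2 := abs_le.1 (hzM y)
    have h3 := abs_lt.1 hy
    linarith
  have hall := (Filter.eventually_all_finset (Finset.range N).powerset).2 fun s _ => hs s
  filter_upwards [hall] with y hy
  refine le_trans (le_of_eq ?_)
    (hy ((Finset.range N).filter fun n => 0 ≤ φ y (w n) - φ x (w n)) (by simp))
  refine Finset.sum_congr rfl fun n hn => ?_
  simp only [ε, Finset.mem_filter, hn, true_and]
  split_ifs with h
  · rw [abs_of_nonneg h, one_mul]
  · rw [abs_of_neg (not_le.1 h), neg_one_mul]

variable [CompactSpace K] [T2Space K] [TotallyDisconnectedSpace K]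

/-- `C(K)`-valued operators extend along exact sequences with quotient `c₀`, if `K` has
finite height. -/
theorem IsScatteredFiltration.exists_extension [CompleteSpace Y] [CompleteSpace Z]
    {A : ℕ → Set K} {n : ℕ} (hA : IsScatteredFiltration A n)
    {j : Y →L[ℝ] Z} {ρ : Z →L[ℝ] C₀(ℕ, ℝ)} (hj : Function.Injective j)
    (hex : Function.Exact j ρ) (hρ : Function.Surjective ρ) (T : Y →L[ℝ] C(K, ℝ)) :
    ∃ P : Z →L[ℝ] C(K, ℝ), ∀ y, P (j y) = T y := by
  obtain ⟨C₁, hC₁, hext⟩ := exists_bounded_functional_extension hj hex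
  choose φ hφ hφn using fun x => hext ((ContinuousMap.evalCLM ℝ x).comp T)
  replace hφ : ∀ x y, φ x (j y) = T y x := hφ
  obtain ⟨M, hM0, hφM⟩ : ∃ M, 0 ≤ M ∧ ∀ x z, |φ x z| ≤ M * ‖z‖ := by
    refine ⟨C₁ * ‖T‖, by positivity, fun x z => ?_⟩
    refine (φ x).le_of_opNorm_le ((hφn x).trans ?_) z
    refine mul_le_mul_of_nonneg_left (ContinuousLinearMap.opNorm_le_bound _
      (ContinuousLinearMap.opNorm_nonneg _)
      fun y => ?_) hC₁
    exact ((T y).norm_coe_le_norm x).trans (T.le_opNorm y)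
  choose w hw using fun n => hρ (CZero.single n)
  obtain ⟨C, hC⟩ := eventually_sum_abs_sub_le hex hρ T hφ hM0 hφM hw
  obtain ⟨c, hc0, f, hf⟩ := hA.isNearContinuousOn (g := fun n x => φ x (w n)) hC
  -- Uniformly in `x` this is a bounded element of ℓ₁, hence a functional on c₀. Subtracting it
  -- gives functionals depending continuously on `x` at each `w n`, without changing them on `Y`.
  let d : K → ℕ → ℝ := fun x n => φ x (w n) - f n x
  have hd : ∀ x, Summable fun n => |d x n| := fun x =>
    summable_of_sum_range_le (fun _ => abs_nonneg _) fun N => hf x trivial N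
  have hdc : ∀ x, ∑' n, |d x n| ≤ c := fun x =>
    Real.tsum_le_of_sum_range_le (fun _ => abs_nonneg _) fun N => hf x trivial N
  have hle : ∀ x (a : C₀(ℕ, ℝ)) n, ‖d x n * a n‖ ≤ |d x n| * ‖a‖ := fun x a n => by
    rw [norm_mul]
    exact mul_le_mul_of_nonneg_left (CZero.abs_apply_le a n) (abs_nonneg _)
  have hsum : ∀ x (a : C₀(ℕ, ℝ)), Summable fun n => d x n * a n := fun x a =>
    Summable.of_norm_bounded ((hd x).mul_right ‖a‖) (hle x a)
  let L : K → C₀(ℕ, ℝ) →ₗ[ℝ] ℝ := fun x =>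
    { toFun := fun a => ∑' n, d x n * a n
      map_add' := fun a b => by
        rw [← (hsum x a).tsum_add (hsum x b)]
        exact tsum_congr fun n => by rw [ZeroAtInftyContinuousMap.add_apply, mul_add]
      map_smul' := fun t a => by
        rw [RingHom.id_apply, smul_eq_mul, ← tsum_mul_left]
        exact tsum_congr fun n => by
          rw [ZeroAtInftyContinuousMap.smul_apply, smul_eq_mul]; ring }
  have hLle : ∀ x a, |L x a| ≤ c * ‖a‖ := fun x a => by
    refine (tsum_of_norm_bounded ((hd x).mul_right ‖a‖).hasSum (hle x a)).trans ?_
    rw [tsum_mul_right]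
    exact mul_le_mul_of_nonneg_right (hdc x) (norm_nonneg _)
  let p : K → Z →ₗ[ℝ] ℝ := fun x => (φ x : Z →ₗ[ℝ] ℝ) - (L x).comp (ρ : Z →ₗ[ℝ] C₀(ℕ, ℝ))
  have hp : ∀ x z, p x z = φ x z - L x (ρ z) := fun _ _ => rfl
  have hpM : ∀ x z, |p x z| ≤ (M + c * ‖ρ‖) * ‖z‖ := fun x z => by
    rw [hp, add_mul, mul_assoc c]
    exact (abs_sub _ _).trans (add_le_add (hφM x z) ((hLle x _).trans
      (mul_le_mul_of_nonneg_left (ρ.le_opNorm z) hc0)))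
  have hρj : ∀ y, ρ (j y) = 0 := fun y => (hex _).2 ⟨y, rfl⟩
  have hpj : ∀ x y, p x (j y) = T y x := fun x y => by rw [hp, hρj, map_zero, sub_zero, hφ]
  have hpw : ∀ x n, p x (w n) = f n x := fun x n => by
    have : L x (CZero.single n) = d x n := by
      show ∑' m, d x m * CZero.single n m = d x n
      rw [tsum_eq_single n fun m hm => by rw [CZero.single_apply, if_neg hm, mul_zero],
        CZero.single_apply, if_pos rfl, mul_one]
    rw [hp, hw, this]
    simp [d]
  let S : Submodule ℝ Z :=
    { carrier := {z | Continuous fun x => p x z}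
      zero_mem' := by simpa using continuous_const
      add_mem' := fun {a b} ha hb => by
        have h : Continuous fun x => p x a + p x b := Continuous.add ha hb
        simpa using h
      smul_mem' := fun a z hz => by
        have h : Continuous fun x => a * p x z := Continuous.const_mul hz a
        simpa using h }
  have hSclosed : IsClosed (S : Set Z) := by
    refine isClosed_of_closure_subset fun z hz => ?_
    obtain ⟨s, hs, hsz⟩ := mem_closure_iff_seq_limit.1 hz
    refine TendstoUniformly.continuous (F := fun n x => p x (s n)) (p := Filter.atTop) ?_
      (Filter.Eventually.frequently (Filter.Eventually.of_forall fun n => hs n))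
    rw [Metric.tendstoUniformly_iff]
    intro ε hε
    have hB : 0 < M + c * ‖ρ‖ + 1 := by positivity
    filter_upwards [hsz.eventually (Metric.ball_mem_nhds z (div_pos hε hB))] with n hn x
    change dist (s n) z < _ at hn
    rw [dist_comm, dist_eq_norm, lt_div_iff₀ hB] at hn
    rw [Real.dist_eq, ← map_sub]
    exact (hpM x _).trans_lt (by nlinarith [norm_nonneg (z - s n)])
  have hStop : S = ⊤ := by
    refine submodule_eq_top_of_exact hex hρ S hSclosed (fun y => ?_) ?_
    · show Continuous _
      simpa [hpj] using (T y).continuous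
    · refine CZero.dense_span_single.mono ?_
      have : Submodule.span ℝ (range CZero.single) ≤ S.map (ρ : Z →ₗ[ℝ] C₀(ℕ, ℝ)) := by
        rw [Submodule.span_le]
        rintro _ ⟨i, rfl⟩
        refine ⟨w i, ?_, hw i⟩
        show Continuous _
        simpa [hpw] using (f i).continuous
      intro a ha
      obtain ⟨z, hz, rfl⟩ := this ha
      exact ⟨z, hz, rfl⟩
  have hcont : ∀ z, Continuous fun x => p x z := fun z => by
    have : z ∈ S := hStop ▸ Submodule.mem_top
    exact this
  refine ⟨LinearMap.mkContinuous ⟨⟨fun z => ⟨fun x => p x z, hcont z⟩, fun a b => ?_⟩,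
    fun t a => ?_⟩ (M + c * ‖ρ‖) fun z => ?_, fun y => ?_⟩
  · ext x; simp
  · ext x; simp
  · exact (ContinuousMap.norm_le _ (by positivity)).2 fun x => hpM x z
  · ext x; exact hpj x y

end Extension

/-! ### Scattered spaces, weight, and the hypotheses of the extension theorem -/

/-- A relatively isolated point would disconnect a preconnected set with more than one point. -/
theorem IsScatteredSpace.totallyDisconnectedSpace {K : Type u} [TopologicalSpace K] [T1Space K]
    (h : IsScatteredSpace K) : TotallyDisconnectedSpace K := by
  refine ⟨fun t _ ht => ?_⟩
  by_contra hnt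
  rw [not_subsingleton_iff] at hnt
  obtain ⟨x, hx, hacc⟩ := h t hnt.nonempty
  rw [accPt_iff_nhds] at hacc
  push Not at hacc
  obtain ⟨U, hU, hUx⟩ := hacc
  obtain ⟨O, hOU, hO, hxO⟩ := mem_nhds_iff.1 hU
  obtain ⟨y, hy, hyx⟩ := hnt.exists_ne x
  obtain ⟨z, hzt, hzO, hzx⟩ := ht O {x}ᶜ hO isOpen_compl_singleton
    (fun z _ => by
      by_cases hz : z = x
      · exact Or.inl (hz ▸ hxO)
      · exact Or.inr hz) ⟨x, hx, hxO⟩ ⟨y, hy, hyx⟩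
  exact hzx (hUx z ⟨hOU hzO, hzt⟩)

theorem exists_isTopologicalBasis_mk_eq_topWeight (K : Type u) [TopologicalSpace K] :
    ∃ B : Set (Set K), IsTopologicalBasis B ∧ #B = topWeight K :=
  csInf_mem (s := {c | ∃ B : Set (Set K), IsTopologicalBasis B ∧ #B = c})
    ⟨_, _, isTopologicalBasis_opens, rfl⟩

/-- A point is determined by its level and a basic open set isolating it there. -/
theorem IsScatteredFiltration.mk_le {K : Type u} [TopologicalSpace K] {A : ℕ → Set K} {n : ℕ}
    (hA : IsScatteredFiltration A n) : #K ≤ max (topWeight K) ℵ₀ := by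
  obtain ⟨B, hB, hBw⟩ := exists_isTopologicalBasis_mk_eq_topWeight K
  have h : ∀ t : K, ∃ p : ULift.{u} ℕ × B, t ∈ A p.1.down ∧ t ∈ p.2.1 ∧
      ∀ y ∈ A p.1.down, y ∈ p.2.1 → y = t := by
    intro t
    obtain ⟨m, -, htm, htm'⟩ := hA.exists_level t
    obtain ⟨b, hb, htb, hbs⟩ := hB.exists_subset_of_mem_open (a := t)
      (show t ∈ (A m \ {t})ᶜ from fun h => h.2 rfl) (hA.isClosed_diff_singleton htm').isOpen_compl
    refine ⟨(⟨m⟩, ⟨b, hb⟩), htm, htb, fun y hy hyb => ?_⟩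
    by_contra hne
    exact hbs hyb ⟨hy, hne⟩
  choose p hp1 hp2 hp3 using h
  have hinj : Function.Injective p := fun s t hst =>
    hp3 t s (hst ▸ hp1 s) (hst ▸ hp2 s)
  refine (mk_le_of_injective hinj).trans ?_
  rw [← hBw, max_comm]
  simpa using mul_le_max_of_aleph0_le_left (b := #B) le_rfl

theorem finite_of_topWeight_lt_aleph0 {K : Type u} [TopologicalSpace K] [T1Space K]
    (h : topWeight K < ℵ₀) : Finite K := by
  obtain ⟨B, hB, hBw⟩ := exists_isTopologicalBasis_mk_eq_topWeight K
  have : Finite B := lt_aleph0_iff_finite.1 (hBw ▸ h)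
  refine Finite.of_injective (fun x : K => {b : B | x ∈ b.1}) fun x y hxy => ?_
  by_contra hne
  obtain ⟨b, hb, hxb, hbs⟩ := hB.exists_subset_of_mem_open (a := x) (u := {y}ᶜ) hne
    isOpen_compl_singleton
  have hmem : (⟨b, hb⟩ : B) ∈ {b : B | x ∈ b.1} := hxb
  simp only at hxy
  rw [hxy] at hmem
  exact hbs hmem rfl

theorem topWeight_eq_mk_of_discrete {K : Type u} [TopologicalSpace K] [DiscreteTopology K] :
    topWeight K = #K := by
  refine le_antisymm (csInf_le' ⟨_, isTopologicalBasis_singletons K, ?_⟩)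
    (le_csInf ⟨_, _, isTopologicalBasis_opens, rfl⟩ ?_)
  · have : {s : Set K | ∃ x, s = {x}} = range (fun x : K => ({x} : Set K)) := by
      ext s; simp [eq_comm]
    rw [this]
    exact mk_range_eq _ singleton_injective
  · rintro _ ⟨B, hB, rfl⟩
    refine mk_le_of_injective (f := fun x : K => (⟨{x}, ?_⟩ : B)) fun x y hxy => ?_
    · obtain ⟨b, hb, hxb, hbs⟩ := hB.exists_subset_of_mem_open (a := x) (u := {x}) rfl
        (isOpen_discrete _)
      rwa [← Subset.antisymm hbs (singleton_subset_iff.2 hxb)]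
    · exact singleton_injective (Subtype.mk.inj hxy)

theorem exists_countable_isNorming (K : Type u) [TopologicalSpace K] [CompactSpace K]
    [SeparableSpace K] : ∃ N : Set (C(K, ℝ) →L[ℝ] ℝ), N.Countable ∧ IsNorming N := by
  obtain ⟨D, hDc, hD⟩ := exists_countable_dense K
  refine ⟨(fun x => ContinuousMap.evalCLM ℝ x) '' D, hDc.image _, ?_, fun f c hc h => ?_⟩
  · rintro _ ⟨x, -, rfl⟩
    refine ContinuousLinearMap.opNorm_le_bound _ zero_le_one fun f => ?_
    rw [one_mul]
    exact f.norm_coe_le_norm x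
  · refine (ContinuousMap.norm_le _ hc).2 fun x => ?_
    have hcl : IsClosed {x | ‖f x‖ ≤ c} := isClosed_le (by fun_prop) continuous_const
    exact closure_minimal (fun y hy => h _ ⟨y, hy, rfl⟩) hcl (hD x)

theorem CZero.isNorming_coord : IsNorming (range CZero.coord) := by
  refine ⟨?_, fun a c hc h => CZero.norm_le hc fun n => h _ ⟨n, rfl⟩⟩
  rintro _ ⟨n, rfl⟩
  exact CZero.norm_coord_le n

/-- For nested spans one of the two components can be absorbed entirely; this covers the unit
vectors of c₀. -/
theorem hasAmalgamation_of_monotone_exhaustion {X : Type*} [NormedAddCommGroup X] [NormedSpace ℝ X]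
    {ι : Type*} (x : ι → X) (F : ℕ → Finset ι) (hF : Monotone F) (hcof : ∀ i, ∃ n, i ∈ F n) :
    HasAmalgamation x := by
  refine ⟨range F, 1, zero_le_one, fun F₀ => ?_, ?_⟩
  · choose n hn using hcof
    exact ⟨_, ⟨F₀.sup n, rfl⟩, fun i hi => hF (Finset.le_sup hi) (hn i)⟩
  · rintro _ ⟨n, rfl⟩ _ ⟨m, rfl⟩ f hf g hg
    rcases le_total n m with h | h
    · have hle : Submodule.span ℝ (x '' F n) ≤ Submodule.span ℝ (x '' F m) :=
        Submodule.span_mono (image_mono (Finset.coe_subset.2 (hF h)))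
      exact ⟨f, ⟨hf, hle hf⟩, by simp⟩
    · have hle : Submodule.span ℝ (x '' F m) ≤ Submodule.span ℝ (x '' F n) :=
        Submodule.span_mono (image_mono (Finset.coe_subset.2 (hF h)))
      exact ⟨-g, Submodule.neg_mem _ ⟨hle hg, hg⟩, by simp⟩

section Extension

variable {Y : Type*} {Z : Type*}
  [NormedAddCommGroup Y] [NormedSpace ℝ Y] [CompleteSpace Y]
  [NormedAddCommGroup Z] [NormedSpace ℝ Z] [CompleteSpace Z]

/-- Sobczyk's theorem, for exact sequences with quotient `c₀`. -/
theorem CZero.exists_extension {j : Y →L[ℝ] Z} {ρ : Z →L[ℝ] C₀(ℕ, ℝ)}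
    (hj : Function.Injective j) (hex : Function.Exact j ρ) (hρ : Function.Surjective ρ)
    (T : Y →L[ℝ] C₀(ℕ, ℝ)) : ∃ P : Z →L[ℝ] C₀(ℕ, ℝ), ∀ y, P (j y) = T y :=
  martinAxiom_aleph0.exists_extension_czero le_rfl mk_nat.le CZero.dense_span_single
    (hasAmalgamation_of_monotone_exhaustion _ Finset.range Finset.range_mono
      fun i => ⟨i + 1, Finset.self_mem_range_succ i⟩)
    CZero.isNorming_coord (countable_range _) hj hex hρ T

variable {K : Type u} [TopologicalSpace K] [CompactSpace K] [T2Space K] [SeparableSpace K]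

/-- Under Martin's axiom, `c₀`-valued operators extend along exact sequences with quotient
`C(K)`, for `K` separable of finite height. -/
theorem MartinAxiom.exists_extension_of_hasFiniteHeight {κ : Cardinal.{u}} (hMA : MartinAxiom κ)
    (hh : HasFiniteHeight K) (hw : topWeight K = κ)
    {j : Y →L[ℝ] Z} {ρ : Z →L[ℝ] C(K, ℝ)} (hj : Function.Injective j) (hex : Function.Exact j ρ)
    (hρ : Function.Surjective ρ) (T : Y →L[ℝ] C₀(ℕ, ℝ)) :
    ∃ P : Z →L[ℝ] C₀(ℕ, ℝ), ∀ y, P (j y) = T y := by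
  obtain ⟨n, hA⟩ := hh.exists_filtration
  obtain ⟨e, he⟩ := hA.exists_triangular
  obtain ⟨N, hNc, hN⟩ := exists_countable_isNorming K
  exact hMA.max_aleph0.exists_extension_czero (le_max_right _ _) (hw ▸ hA.mk_le)
    (hA.dense_span he) (hA.hasAmalgamation he) hN hNc hj hex hρ T

/-- A three-space argument: extend first to the preimage `W` of c₀ × 0 by Sobczyk's theorem, then
from `W` to `Z` with quotient C(K). -/
theorem MartinAxiom.exists_extension_prod {κ : Cardinal.{u}} (hMA : MartinAxiom κ)
    (hh : HasFiniteHeight K) (hw : topWeight K = κ)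
    {j : Y →L[ℝ] Z} {ρ : Z →L[ℝ] C₀(ℕ, ℝ) × C(K, ℝ)} (hj : Function.Injective j)
    (hex : Function.Exact j ρ) (hρ : Function.Surjective ρ) (T : Y →L[ℝ] C₀(ℕ, ℝ)) :
    ∃ P : Z →L[ℝ] C₀(ℕ, ℝ), ∀ y, P (j y) = T y := by
  let ρ₂ : Z →L[ℝ] C(K, ℝ) := (ContinuousLinearMap.snd ℝ _ _).comp ρ
  have hρ₂ : ∀ z, ρ₂ z = (ρ z).2 := fun _ => rfl
  let W := LinearMap.ker (ρ₂ : Z →ₗ[ℝ] C(K, ℝ))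
  have hW : ∀ z, z ∈ W ↔ (ρ z).2 = 0 := fun z => LinearMap.mem_ker
  have : CompleteSpace W := ρ₂.isClosed_ker.completeSpace_coe
  have hρj : ∀ y, ρ (j y) = 0 := fun y => (hex _).2 ⟨y, rfl⟩
  let j₁ : Y →L[ℝ] W := j.codRestrict W fun y => (hW _).2 (by rw [hρj]; rfl)
  let ρ₁ : W →L[ℝ] C₀(ℕ, ℝ) := ((ContinuousLinearMap.fst ℝ _ _).comp ρ).comp W.subtypeL
  obtain ⟨P₁, hP₁⟩ := CZero.exists_extension (j := j₁) (ρ := ρ₁)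
    (fun a b hab => hj (congrArg Subtype.val hab))
    (fun z => by
      constructor
      · intro hz
        obtain ⟨y, hy⟩ := (hex z).1 (Prod.ext hz ((hW _).1 z.2))
        exact ⟨y, Subtype.ext hy⟩
      · rintro ⟨y, rfl⟩
        show (ρ (j y)).1 = 0
        rw [hρj]; rfl)
    (fun a => by
      obtain ⟨z, hz⟩ := hρ (a, 0)
      exact ⟨⟨z, (hW z).2 (by rw [hz])⟩, by show (ρ z).1 = a; rw [hz]⟩) T
  obtain ⟨P, hP⟩ := hMA.exists_extension_of_hasFiniteHeight hh hw (j := W.subtypeL) (ρ := ρ₂)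
    Subtype.val_injective
    (fun z => ⟨fun hz => ⟨⟨z, hz⟩, rfl⟩, by rintro ⟨y, rfl⟩; exact y.2⟩)
    (fun f => by
      obtain ⟨z, hz⟩ := hρ (0, f)
      exact ⟨z, by rw [hρ₂, hz]⟩) P₁
  exact ⟨P, fun y => (hP (j₁ y)).trans (hP₁ y)⟩

end Extension

/-! ### Copies of `c₀` in `C(K)` -/

namespace CZero

theorem exists_operator_prod_of_nat_div_two :
    ∃ P : C₀(ℕ, ℝ) × C₀(ℕ, ℝ) →L[ℝ] C₀(ℕ, ℝ),
      ∀ a b n, P (a, b) n = if Even n then a (n / 2) else b (n / 2) := by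
  obtain ⟨P, hP⟩ := exists_operator (Z := C₀(ℕ, ℝ) × C₀(ℕ, ℝ))
    (fun n => if Even n then ((coord (n / 2) : C₀(ℕ, ℝ) →ₗ[ℝ] ℝ)).comp (LinearMap.fst ℝ _ _)
      else ((coord (n / 2) : C₀(ℕ, ℝ) →ₗ[ℝ] ℝ)).comp (LinearMap.snd ℝ _ _)) 1
    (fun n z => by
      rw [one_mul]
      split_ifs
      · exact (abs_apply_le z.1 _).trans (norm_fst_le z)
      · exact (abs_apply_le z.2 _).trans (norm_snd_le z))
    (fun z => by
      have ht := Nat.tendsto_div_const_atTop two_ne_zero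
      have h1 := ((tendsto_atTop z.1).comp ht).norm.add ((tendsto_atTop z.2).comp ht).norm
      simp only [norm_zero, add_zero] at h1
      refine squeeze_zero_norm (fun n => ?_) h1
      split_ifs
      · exact le_add_of_nonneg_right (norm_nonneg _)
      · exact le_add_of_nonneg_left (norm_nonneg _))
  refine ⟨P, fun a b n => ?_⟩
  rw [hP]
  split_ifs <;> rfl

theorem exists_operator_comp {f : ℕ → ℕ} (hf : Function.Injective f) :
    ∃ P : C₀(ℕ, ℝ) →L[ℝ] C₀(ℕ, ℝ), ∀ a n, P a n = a (f n) :=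
  exists_operator (fun n => (coord (f n) : C₀(ℕ, ℝ) →ₗ[ℝ] ℝ)) 1
    (fun n z => by rw [one_mul]; exact abs_apply_le z _)
    (fun z => (tendsto_atTop z).comp hf.nat_tendsto_atTop)

theorem nonempty_equiv_prod : Nonempty ((C₀(ℕ, ℝ) × C₀(ℕ, ℝ)) ≃L[ℝ] C₀(ℕ, ℝ)) := by
  obtain ⟨P, hP⟩ := exists_operator_prod_of_nat_div_two
  obtain ⟨P₁, hP₁⟩ := exists_operator_comp (f := fun n => 2 * n) fun a b h => by
    simp only at h; omega
  obtain ⟨P₂, hP₂⟩ := exists_operator_comp (f := fun n => 2 * n + 1) fun a b h => by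
    simp only at h; omega
  refine ⟨ContinuousLinearEquiv.equivOfInverse P (P₁.prod P₂) ?_ ?_⟩
  · rintro ⟨a, b⟩
    refine Prod.ext ?_ ?_
    · ext n
      show P₁ (P (a, b)) n = a n
      rw [hP₁, hP, if_pos (even_two_mul n), Nat.mul_div_cancel_left n two_pos]
    · ext n
      show P₂ (P (a, b)) n = b n
      rw [hP₂, hP, if_neg (by simp)]
      congr 1
      omega
  · intro a
    ext n
    show P (P₁ a, P₂ a) n = a n
    rw [hP, hP₁, hP₂]
    split_ifs with h
    · rw [Nat.two_mul_div_two_of_even h]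
    · rw [Nat.two_mul_div_two_add_one_of_odd (Nat.not_even_iff_odd.1 h)]

theorem nonempty_equiv_prod_prod (X : Type*) [NormedAddCommGroup X] [NormedSpace ℝ X] :
    Nonempty ((C₀(ℕ, ℝ) × C₀(ℕ, ℝ) × X) ≃L[ℝ] C₀(ℕ, ℝ) × X) := by
  obtain ⟨e⟩ := nonempty_equiv_prod
  exact ⟨(ContinuousLinearEquiv.prodAssoc ℝ _ _ _).symm.trans
    (e.prodCongr (ContinuousLinearEquiv.refl ℝ X))⟩

/-- If X ≃ c₀ ⊕ E, then c₀ ⊕ X ≃ c₀ ⊕ c₀ ⊕ E ≃ c₀ ⊕ E. -/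
theorem nonempty_equiv_prod_of_complemented {X : Type*} [NormedAddCommGroup X] [NormedSpace ℝ X]
    [CompleteSpace X] (i : C₀(ℕ, ℝ) →L[ℝ] X) (p : X →L[ℝ] C₀(ℕ, ℝ)) (hpi : ∀ a, p (i a) = a) :
    Nonempty ((C₀(ℕ, ℝ) × X) ≃L[ℝ] X) := by
  let E := LinearMap.ker (p : X →ₗ[ℝ] C₀(ℕ, ℝ))
  have : CompleteSpace E := p.isClosed_ker.completeSpace_coe
  let Q : X →L[ℝ] E := (ContinuousLinearMap.id ℝ X - i.comp p).codRestrict E fun x => by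
    show p (x - i (p x)) = 0
    rw [map_sub, hpi, sub_self]
  obtain ⟨e⟩ := nonempty_equiv_prod_of_retraction (j := E.subtypeL) (ρ := p)
    (fun x => ⟨fun hx => ⟨⟨x, hx⟩, rfl⟩, by rintro ⟨y, rfl⟩; exact y.2⟩)
    (fun a => ⟨i a, hpi a⟩) Q (fun y => Subtype.ext (by
      show (y : X) - i (p y) = y
      rw [show p (y : X) = 0 from y.2, map_zero, sub_zero]))
  obtain ⟨e'⟩ := nonempty_equiv_prod_prod E
  let e'' := e.trans (ContinuousLinearEquiv.prodComm ℝ _ _)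
  exact ⟨((ContinuousLinearEquiv.refl ℝ _).prodCongr e'').trans (e'.trans e''.symm)⟩

end CZero

theorem Set.Countable.exists_injective_range_eq {α : Type*} {s : Set α} (hs : s.Countable) (hi : s.Infinite) :
    ∃ e : ℕ → α, Function.Injective e ∧ range e = s := by
  have := hs.to_subtype
  have := hi.to_subtype
  obtain ⟨d⟩ := nonempty_denumerable s
  refine ⟨fun n => ((Denumerable.eqv s).symm n : α), ?_, ?_⟩
  · exact Subtype.val_injective.comp (Denumerable.eqv s).symm.injective
  · have := (Denumerable.eqv s).symm.surjective.range_comp (Subtype.val : s → α)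
    exact this.trans Subtype.range_coe

section Isolated

variable {K : Type u} [TopologicalSpace K]

theorem isOpen_singleton_of_notMem_derivedSet {x : K} (hx : x ∉ derivedSet (Set.univ : Set K)) :
    IsOpen ({x} : Set K) := by
  rw [isOpen_singleton_iff_punctured_nhds]
  simpa [mem_derivedSet, AccPt, Filter.neBot_iff] using hx

theorem countable_compl_derivedSet [SeparableSpace K] :
    (derivedSet (Set.univ : Set K))ᶜ.Countable := by
  obtain ⟨D, hDc, hD⟩ := exists_countable_dense K
  refine hDc.mono fun x hx => ?_
  obtain ⟨y, hy, hyD⟩ := hD.inter_open_nonempty _ (isOpen_singleton_of_notMem_derivedSet hx)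
    ⟨x, rfl⟩
  rwa [← mem_singleton_iff.1 hy]

/-- Otherwise K' would be open and nonempty, and a point isolated in K' would be isolated in K. -/
theorem IsScatteredSpace.infinite_compl_derivedSet [T1Space K] [Infinite K] (hs : IsScatteredSpace K) :
    (derivedSet (Set.univ : Set K))ᶜ.Infinite := by
  intro hfin
  have hopen : IsOpen (derivedSet (Set.univ : Set K)) := by
    rw [← isClosed_compl_iff]
    exact hfin.isClosed
  have hne : (derivedSet (Set.univ : Set K)).Nonempty := by
    by_contra hemp
    rw [not_nonempty_iff_eq_empty] at hemp
    rw [hemp, compl_empty] at hfin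
    exact Set.infinite_univ hfin
  obtain ⟨x, hx, hacc⟩ := hs _ hne
  have h1 : AccPt x (Filter.principal Set.univ) := hx
  rw [accPt_iff_nhds] at h1 hacc
  refine hacc fun U hU => ?_
  obtain ⟨y, hy, hyx⟩ := h1 _ (Filter.inter_mem hU (hopen.mem_nhds hx))
  exact ⟨y, hy.1, hyx⟩

variable [CompactSpace K]

theorem IsClosed.finite_of_disjoint_derivedSet {B : Set K} (hB : IsClosed B)
    (hd : ∀ x ∈ B, x ∉ derivedSet (Set.univ : Set K)) : B.Finite := by
  by_contra hinf
  obtain ⟨x, hx, hacc⟩ := Set.Infinite.exists_accPt_of_subset_isCompact hinf hB.isCompact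
    subset_rfl
  exact hd x hx (derivedSet_mono _ _ (subset_univ _) hacc)

/-- The points of `B` with |f| ≥ ε form a closed set of isolated points, which is finite. -/
theorem tendsto_comp_of_isolated {e : ℕ → K} (he : Function.Injective e) {B : Set K}
    (hB : IsClosed B) (heB : ∀ n, e n ∈ B) {f : C(K, ℝ)}
    (hf : ∀ y ∈ B, y ∈ derivedSet (Set.univ : Set K) → f y = 0) :
    Filter.Tendsto (fun n => f (e n)) Filter.atTop (𝓝 0) := by
  rw [← Nat.cofinite_eq_atTop, Metric.tendsto_nhds]
  intro ε hε
  have hcl : IsClosed (B ∩ {y | ε ≤ |f y|}) :=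
    hB.inter (isClosed_le continuous_const (by fun_prop))
  have hfin := hcl.finite_of_disjoint_derivedSet fun y hy hy' => by
    have := hy.2
    rw [mem_ofPred_eq, hf y hy.1 hy', abs_zero] at this
    exact absurd hε (not_lt.2 this)
  refine (hfin.preimage he.injOn).subset fun n hn => ⟨heB n, ?_⟩
  simpa using hn

variable [T2Space K]

theorem exists_operator_of_isolated {e : ℕ → K} (he : Function.Injective e)
    (hiso : ∀ n, e n ∉ derivedSet (Set.univ : Set K)) :
    ∃ i : C₀(ℕ, ℝ) →L[ℝ] C(K, ℝ), (∀ a n, i a (e n) = a n) ∧ ∀ a, ∀ x ∉ range e, i a x = 0 := by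
  let F : C₀(ℕ, ℝ) → K → ℝ := fun a => Function.extend e a 0
  have hF : ∀ a n, F a (e n) = a n := fun a n => he.extend_apply _ _ _
  have hF' : ∀ a, ∀ x ∉ range e, F a x = 0 := fun a x hx =>
    Function.extend_apply' _ _ _ fun ⟨n, hn⟩ => hx ⟨n, hn⟩
  have hcont : ∀ a, Continuous (F a) := by
    intro a
    rw [continuous_iff_continuousAt]
    intro x
    by_cases hx : x ∈ range e
    · obtain ⟨n, rfl⟩ := hx
      have := isOpen_singleton_of_notMem_derivedSet (hiso n)
      rw [ContinuousAt, (isOpen_singleton_iff_nhds_eq_pure _).1 this]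
      exact tendsto_pure_nhds _ _
    · rw [ContinuousAt, hF' a x hx, Metric.tendsto_nhds]
      intro ε hε
      have hfin : {n | ε ≤ |a n|}.Finite := by
        have := (CZero.tendsto_atTop a).eventually (Metric.ball_mem_nhds 0 hε)
        rw [← Nat.cofinite_eq_atTop, Filter.eventually_cofinite] at this
        simpa using this
      have hcl := (hfin.image e).isClosed
      filter_upwards [hcl.isOpen_compl.mem_nhds fun ⟨n, _, hn⟩ => hx ⟨n, hn⟩] with y hy
      rw [dist_zero_right, Real.norm_eq_abs]
      by_cases hye : y ∈ range e
      · obtain ⟨n, rfl⟩ := hye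
        rw [hF]
        by_contra hlt
        exact hy ⟨n, not_lt.1 hlt, rfl⟩
      · rwa [hF' a y hye, abs_zero]
  have hext : ∀ {f g : C(K, ℝ)}, (∀ n, f (e n) = g (e n)) → (∀ x ∉ range e, f x = g x) → f = g := by
    intro f g h h'
    ext x
    by_cases hx : x ∈ range e
    · obtain ⟨n, rfl⟩ := hx
      exact h n
    · exact h' x hx
  refine ⟨LinearMap.mkContinuous ⟨⟨fun a => ⟨F a, hcont a⟩, fun a b => hext ?_ ?_⟩,
    fun t a => hext ?_ ?_⟩ 1 fun a => ?_, hF, hF'⟩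
  · intro n; simp [hF]
  · intro x hx; simp [hF' _ x hx]
  · intro n; simp [hF]
  · intro x hx; simp [hF' _ x hx]
  · rw [one_mul]
    refine (ContinuousMap.norm_le _ (norm_nonneg _)).2 fun x => ?_
    show |F a x| ≤ ‖a‖
    by_cases hx : x ∈ range e
    · obtain ⟨n, rfl⟩ := hx
      rw [hF]
      exact CZero.abs_apply_le a n
    · rw [hF' a x hx, abs_zero]
      exact norm_nonneg _

/-- Restriction of continuous functions to a subset. -/
noncomputable def restrictCLM (s : Set K) [CompactSpace s] : C(K, ℝ) →L[ℝ] C(s, ℝ) :=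
  LinearMap.mkContinuous ⟨⟨fun f => f.restrict s, fun _ _ => rfl⟩, fun _ _ => rfl⟩ 1 fun f => by
    rw [one_mul]
    exact (ContinuousMap.norm_le _ (norm_nonneg _)).2 fun x => f.norm_coe_le_norm x

instance compactSpace_derivedSet : CompactSpace (derivedSet (Set.univ : Set K)) :=
  isCompact_iff_compactSpace.1 (isClosed_derivedSet _).isCompact

/-- The exact sequence `0 → c₀ → C(K) → C(K') → 0`. -/
theorem IsScatteredSpace.exists_exact [Infinite K] [SeparableSpace K] (hs : IsScatteredSpace K) :
    ∃ i : C₀(ℕ, ℝ) →L[ℝ] C(K, ℝ), Function.Injective i ∧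
      Function.Exact i (restrictCLM (derivedSet (Set.univ : Set K))) ∧
      Function.Surjective (restrictCLM (derivedSet (Set.univ : Set K))) := by
  obtain ⟨e, he, hrange⟩ := countable_compl_derivedSet.exists_injective_range_eq
    hs.infinite_compl_derivedSet
  have hiso : ∀ n, e n ∉ derivedSet (Set.univ : Set K) := fun n => by
    have : e n ∈ range e := ⟨n, rfl⟩
    rwa [hrange] at this
  obtain ⟨i, hi, hi'⟩ := exists_operator_of_isolated he hiso
  refine ⟨i, fun a b hab => ?_, fun f => ⟨fun hf => ?_, ?_⟩, fun f => ?_⟩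
  · ext n
    rw [← hi, ← hi, hab]
  · have hf0 : ∀ y ∈ derivedSet (Set.univ : Set K), f y = 0 := fun y hy =>
      DFunLike.congr_fun hf (⟨y, hy⟩ : derivedSet (Set.univ : Set K))
    refine ⟨CZero.mk _ (tendsto_comp_of_isolated he isClosed_univ (fun _ => trivial)
      (f := f) fun y _ => hf0 y), ?_⟩
    ext x
    by_cases hx : x ∈ range e
    · obtain ⟨n, rfl⟩ := hx
      rw [hi, CZero.mk_apply]
    · rw [hi' _ x hx, hf0]
      rw [hrange, notMem_compl_iff] at hx
      exact hx
  · rintro ⟨a, rfl⟩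
    ext x
    exact hi' a x (by rw [hrange]; exact fun h => h x.2)
  · obtain ⟨g, hg⟩ := f.exists_restrict_eq (isClosed_derivedSet _)
    exact ⟨g, hg⟩

/-- A point `x` isolated in K' has a clopen neighbourhood `V` whose other points are isolated in K,
so `V` is a convergent sequence with its limit. Then f ↦ (f(eₙ) - f(x)) is a left inverse of the
embedding of c₀. -/
theorem IsScatteredSpace.nonempty_equiv_prod [Infinite K] [SeparableSpace K]
    (hs : IsScatteredSpace K) : Nonempty ((C₀(ℕ, ℝ) × C(K, ℝ)) ≃L[ℝ] C(K, ℝ)) := by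
  have := hs.totallyDisconnectedSpace
  have hne : (derivedSet (Set.univ : Set K)).Nonempty := by
    by_contra hemp
    rw [not_nonempty_iff_eq_empty] at hemp
    exact Set.infinite_univ
      (isClosed_univ.finite_of_disjoint_derivedSet (K := K) fun x _ => by simp [hemp])
  obtain ⟨x, hx, hacc⟩ := hs _ hne
  rw [accPt_iff_nhds] at hacc
  push Not at hacc
  obtain ⟨U, hU, hUx⟩ := hacc
  obtain ⟨O, hOU, hO, hxO⟩ := mem_nhds_iff.1 hU
  obtain ⟨V, hV, hxV, hVO⟩ := compact_exists_isClopen_in_isOpen hO hxO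
  have hVx : ∀ y ∈ V, y ∈ derivedSet (Set.univ : Set K) → y = x := fun y hy hy' =>
    hUx y ⟨hOU (hVO hy), hy'⟩
  have hinf : (V \ {x}).Infinite := by
    intro hfin
    have h1 : AccPt x (Filter.principal Set.univ) := hx
    rw [accPt_iff_nhds] at h1
    obtain ⟨y, hy, hyx⟩ := h1 _ ((hV.isOpen.sdiff hfin.isClosed).mem_nhds ⟨hxV, fun h => h.2 rfl⟩)
    exact hy.1.2 ⟨hy.1.1, hyx⟩
  have hsub : V \ {x} ⊆ (derivedSet (Set.univ : Set K))ᶜ := fun y hy hy' => hy.2 (hVx y hy.1 hy')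
  obtain ⟨e, he, hrange⟩ := (countable_compl_derivedSet.mono hsub).exists_injective_range_eq hinf
  have hmem : ∀ n, e n ∈ V \ {x} := fun n => hrange ▸ ⟨n, rfl⟩
  obtain ⟨i, hi, hi'⟩ := exists_operator_of_isolated he fun n => hsub (hmem n)
  obtain ⟨p, hp⟩ := CZero.exists_operator
    (fun n => ((ContinuousMap.evalCLM ℝ (e n) - ContinuousMap.evalCLM ℝ x :
      C(K, ℝ) →L[ℝ] ℝ) : C(K, ℝ) →ₗ[ℝ] ℝ)) 2
    (fun n f => by
      show |f (e n) - f x| ≤ 2 * ‖f‖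
      have h1 := f.norm_coe_le_norm (e n)
      have h2 := f.norm_coe_le_norm x
      rw [Real.norm_eq_abs] at h1 h2
      refine (abs_sub _ _).trans ?_
      linarith)
    (fun f => tendsto_comp_of_isolated he hV.isClosed (fun n => (hmem n).1)
      (f := f - ContinuousMap.const K (f x)) fun y hy hy' => by
        rw [hVx y hy hy']; simp)
  refine CZero.nonempty_equiv_prod_of_complemented i p fun a => ?_
  ext n
  rw [hp]
  show i a (e n) - i a x = a n
  rw [hi, hi' a x (by rw [hrange]; exact fun h => h.2 rfl), sub_zero]

end Isolated

/-! ### Twisted sums with `c₀` -/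

/-- The pullback W = {(x₀, x₁) : ρ₀ x₀ = ρ₁ x₁} is a twisted sum of c₀ with `X₀` and also with `X₁`.
When both sequences split, W is isomorphic to both products. -/
theorem nonempty_equiv_of_pullback {X₀ X₁ : Type u} {X : Type*}
    [NormedAddCommGroup X₀] [NormedSpace ℝ X₀] [CompleteSpace X₀]
    [NormedAddCommGroup X₁] [NormedSpace ℝ X₁] [CompleteSpace X₁]
    [NormedAddCommGroup X] [NormedSpace ℝ X]
    {j₀ : C₀(ℕ, ℝ) →L[ℝ] X₀} {ρ₀ : X₀ →L[ℝ] X} {j₁ : C₀(ℕ, ℝ) →L[ℝ] X₁} {ρ₁ : X₁ →L[ℝ] X}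
    (hj₀ : Function.Injective j₀) (hex₀ : Function.Exact j₀ ρ₀) (hρ₀ : Function.Surjective ρ₀)
    (hj₁ : Function.Injective j₁) (hex₁ : Function.Exact j₁ ρ₁) (hρ₁ : Function.Surjective ρ₁)
    (h₀ : ∀ (W : Type u) [NormedAddCommGroup W] [NormedSpace ℝ W] [CompleteSpace W]
      (j : C₀(ℕ, ℝ) →L[ℝ] W)
      (ρ : W →L[ℝ] X₀), Function.Injective j → Function.Exact j ρ → Function.Surjective ρ →
        ∃ P : W →L[ℝ] C₀(ℕ, ℝ), ∀ y, P (j y) = y)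
    (h₁ : ∀ (W : Type u) [NormedAddCommGroup W] [NormedSpace ℝ W] [CompleteSpace W]
      (j : C₀(ℕ, ℝ) →L[ℝ] W)
      (ρ : W →L[ℝ] X₁), Function.Injective j → Function.Exact j ρ → Function.Surjective ρ →
        ∃ P : W →L[ℝ] C₀(ℕ, ℝ), ∀ y, P (j y) = y) :
    Nonempty ((C₀(ℕ, ℝ) × X₀) ≃L[ℝ] C₀(ℕ, ℝ) × X₁) := by
  let δ : X₀ × X₁ →L[ℝ] X :=
    ρ₀.comp (ContinuousLinearMap.fst ℝ X₀ X₁) - ρ₁.comp (ContinuousLinearMap.snd ℝ X₀ X₁)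
  let W := LinearMap.ker (δ : X₀ × X₁ →ₗ[ℝ] X)
  have hW : ∀ z, z ∈ W ↔ ρ₀ z.1 = ρ₁ z.2 := fun z => by
    rw [LinearMap.mem_ker]
    exact sub_eq_zero
  have : CompleteSpace W := δ.isClosed_ker.completeSpace_coe
  have hρj₀ : ∀ y, ρ₀ (j₀ y) = 0 := fun y => (hex₀ _).2 ⟨y, rfl⟩
  have hρj₁ : ∀ y, ρ₁ (j₁ y) = 0 := fun y => (hex₁ _).2 ⟨y, rfl⟩
  let i₀ : C₀(ℕ, ℝ) →L[ℝ] W := ((ContinuousLinearMap.inl ℝ X₀ X₁).comp j₀).codRestrict W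
    fun y => (hW _).2 (by simp [hρj₀])
  let i₁ : C₀(ℕ, ℝ) →L[ℝ] W := ((ContinuousLinearMap.inr ℝ X₀ X₁).comp j₁).codRestrict W
    fun y => (hW _).2 (by simp [hρj₁])
  let π₀ : W →L[ℝ] X₀ := (ContinuousLinearMap.fst ℝ X₀ X₁).comp W.subtypeL
  let π₁ : W →L[ℝ] X₁ := (ContinuousLinearMap.snd ℝ X₀ X₁).comp W.subtypeL
  have hi₀ : Function.Injective i₀ := fun a b hab =>
    hj₀ (congrArg (fun z : W => (z : X₀ × X₁).1) hab)
  have hi₁ : Function.Injective i₁ := fun a b hab =>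
    hj₁ (congrArg (fun z : W => (z : X₀ × X₁).2) hab)
  have hiπ₀ : Function.Exact i₀ π₁ := by
    rintro ⟨⟨z₀, z₁⟩, hz⟩
    constructor
    · rintro (rfl : z₁ = 0)
      have hz' : ρ₀ z₀ = 0 := ((hW _).1 hz).trans (map_zero ρ₁)
      obtain ⟨y, rfl⟩ := (hex₀ _).1 hz'
      exact ⟨y, rfl⟩
    · rintro ⟨y, hy⟩
      exact (congrArg (fun z : W => (z : X₀ × X₁).2) hy).symm
  have hiπ₁ : Function.Exact i₁ π₀ := by
    rintro ⟨⟨z₀, z₁⟩, hz⟩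
    constructor
    · rintro (rfl : z₀ = 0)
      have hz' : ρ₁ z₁ = 0 := ((hW _).1 hz).symm.trans (map_zero ρ₀)
      obtain ⟨y, rfl⟩ := (hex₁ _).1 hz'
      exact ⟨y, rfl⟩
    · rintro ⟨y, hy⟩
      exact (congrArg (fun z : W => (z : X₀ × X₁).1) hy).symm
  have hπ₀ : Function.Surjective π₀ := fun x => by
    obtain ⟨z, hz⟩ := hρ₁ (ρ₀ x)
    exact ⟨⟨(x, z), (hW _).2 hz.symm⟩, rfl⟩
  have hπ₁ : Function.Surjective π₁ := fun x => by
    obtain ⟨z, hz⟩ := hρ₀ (ρ₁ x)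
    exact ⟨⟨(z, x), (hW _).2 hz⟩, rfl⟩
  obtain ⟨P₀, hP₀⟩ := h₀ W i₁ π₀ hi₁ hiπ₁ hπ₀
  obtain ⟨P₁, hP₁⟩ := h₁ W i₀ π₁ hi₀ hiπ₀ hπ₁
  obtain ⟨e₀⟩ := nonempty_equiv_prod_of_retraction hiπ₁ hπ₀ P₀ hP₀
  obtain ⟨e₁⟩ := nonempty_equiv_prod_of_retraction hiπ₀ hπ₁ P₁ hP₁
  exact ⟨e₀.symm.trans e₁⟩

section TwistedSum

variable {K : Type u} [TopologicalSpace K] [CompactSpace K] [T2Space K] [SeparableSpace K]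
  {κ : Cardinal.{u}}

theorem IsTwistedSum.nonempty_equiv_prod (hMA : MartinAxiom κ) (hh : HasFiniteHeight K)
    (hw : topWeight K = κ) {X : Type v} [NormedAddCommGroup X] [NormedSpace ℝ X] [CompleteSpace X]
    (h : IsTwistedSum C₀(ℕ, ℝ) X C(K, ℝ)) : Nonempty (X ≃L[ℝ] C₀(ℕ, ℝ) × C(K, ℝ)) := by
  obtain ⟨j, ρ, hj, hex, hρ⟩ := h
  obtain ⟨P, hP⟩ := hMA.exists_extension_of_hasFiniteHeight hh hw hj hex hρ
    (ContinuousLinearMap.id ℝ _)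
  exact nonempty_equiv_prod_of_retraction hex hρ P hP

theorem IsTwistedSumWithC0.nonempty_equiv_prod (hMA : MartinAxiom κ) (hs : IsScatteredSpace K)
    (hh : HasFiniteHeight K) (hw : topWeight K = κ) {W : Type w} {Z : Type v}
    [NormedAddCommGroup W] [NormedSpace ℝ W] [CompleteSpace W]
    [NormedAddCommGroup Z] [NormedSpace ℝ Z] [CompleteSpace Z]
    (e : W ≃L[ℝ] C₀(ℕ, ℝ) × C(K, ℝ)) (h : IsTwistedSumWithC0 Z W) :
    Nonempty (Z ≃L[ℝ] C₀(ℕ, ℝ) × C(K, ℝ)) := by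
  obtain ⟨e'⟩ := CZero.nonempty_equiv_prod_prod C(K, ℝ)
  rcases h with ⟨j, ρ, hj, hex, hρ⟩ | ⟨j, ρ, hj, hex, hρ⟩
  · obtain ⟨P, hP⟩ := hMA.exists_extension_prod hh hw (j := j)
      (ρ := (e : W →L[ℝ] C₀(ℕ, ℝ) × C(K, ℝ)).comp ρ) hj
      (fun z => by
        rw [← hex z]
        exact e.map_eq_zero_iff)
      (e.surjective.comp hρ) (ContinuousLinearMap.id ℝ _)
    obtain ⟨e''⟩ := nonempty_equiv_prod_of_retraction hex hρ P hP
    exact ⟨e''.trans (((ContinuousLinearEquiv.refl ℝ _).prodCongr e).trans e')⟩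
  · have := hs.totallyDisconnectedSpace
    obtain ⟨n, hA⟩ := hh.exists_filtration
    -- Now c₀ is the quotient: the two components of `W` are retracted onto separately, by extending
    -- both coordinates of `e`.
    obtain ⟨P₁, hP₁⟩ := CZero.exists_extension hj hex hρ
      ((ContinuousLinearMap.fst ℝ _ _).comp (e : W →L[ℝ] C₀(ℕ, ℝ) × C(K, ℝ)))
    obtain ⟨P₂, hP₂⟩ := hA.exists_extension hj hex hρ
      ((ContinuousLinearMap.snd ℝ _ _).comp (e : W →L[ℝ] C₀(ℕ, ℝ) × C(K, ℝ)))
    obtain ⟨e''⟩ := nonempty_equiv_prod_of_retraction hex hρ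
      ((e.symm : C₀(ℕ, ℝ) × C(K, ℝ) →L[ℝ] W).comp (P₁.prod P₂)) fun y => by
        show e.symm (P₁ (j y), P₂ (j y)) = y
        rw [hP₁, hP₂]
        exact e.symm_apply_apply y
    exact ⟨e''.trans ((ContinuousLinearEquiv.prodComm ℝ _ _).trans
      (((ContinuousLinearEquiv.refl ℝ _).prodCongr e).trans e'))⟩

theorem IsIteratedTwistedSum.nonempty_equiv_prod (hMA : MartinAxiom κ) (hs : IsScatteredSpace K)
    (hh : HasFiniteHeight K) (hw : topWeight K = κ) {X : Type w} {Z : Type v}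
    [NormedAddCommGroup X] [NormedSpace ℝ X] [CompleteSpace X]
    [NormedAddCommGroup Z] [NormedSpace ℝ Z] [CompleteSpace Z]
    (e : X ≃L[ℝ] C₀(ℕ, ℝ) × C(K, ℝ)) (h : IsIteratedTwistedSum X Z) :
    Nonempty (Z ≃L[ℝ] C₀(ℕ, ℝ) × C(K, ℝ)) := by
  induction h with
  | base Z hZ => exact hZ.nonempty_equiv_prod hMA hs hh hw e
  | step W Z _ hZ ih =>
    obtain ⟨e'⟩ := ih
    exact hZ.nonempty_equiv_prod hMA hs hh hw e'

theorem nonempty_equiv_of_derivedSet {K₀ K₁ : Type u}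
    [TopologicalSpace K₀] [CompactSpace K₀] [T2Space K₀] [SeparableSpace K₀]
    [TopologicalSpace K₁] [CompactSpace K₁] [T2Space K₁] [SeparableSpace K₁] (hMA : MartinAxiom κ)
    (hs₀ : IsScatteredSpace K₀) (hh₀ : HasFiniteHeight K₀) (hw₀ : topWeight K₀ = κ)
    (hs₁ : IsScatteredSpace K₁) (hh₁ : HasFiniteHeight K₁) (hw₁ : topWeight K₁ = κ)
    (e : C(derivedSet (Set.univ : Set K₀), ℝ) ≃L[ℝ] C(derivedSet (Set.univ : Set K₁), ℝ)) :
    Nonempty (C(K₀, ℝ) ≃L[ℝ] C(K₁, ℝ)) := by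
  -- For finite κ both spaces are finite and the weight is the number of points, so the conclusion
  -- comes from equal weights; the derived sets carry no information.
  rcases lt_or_ge κ ℵ₀ with hκ | hκ
  · have := finite_of_topWeight_lt_aleph0 (hw₀.trans_lt hκ)
    have := finite_of_topWeight_lt_aleph0 (hw₁.trans_lt hκ)
    have hcard : #K₀ = #K₁ := by
      rw [← topWeight_eq_mk_of_discrete, ← topWeight_eq_mk_of_discrete, hw₀, hw₁]
    obtain ⟨σ⟩ := Cardinal.eq.1 hcard
    have hc : ∀ {A B : Type u} [TopologicalSpace A] [TopologicalSpace B] [CompactSpace A]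
        [CompactSpace B] (φ : C(A, B)),
        ∃ T : C(B, ℝ) →L[ℝ] C(A, ℝ), ∀ f x, T f x = f (φ x) := fun φ =>
      ⟨LinearMap.mkContinuous ⟨⟨fun f => f.comp φ, fun _ _ => rfl⟩, fun _ _ => rfl⟩ 1 fun f => by
        rw [one_mul]
        exact (ContinuousMap.norm_le _ (norm_nonneg _)).2 fun x => f.norm_coe_le_norm _,
        fun _ _ => rfl⟩
    obtain ⟨T, hT⟩ := hc ⟨σ.symm, continuous_of_discreteTopology⟩
    obtain ⟨T', hT'⟩ := hc ⟨σ, continuous_of_discreteTopology⟩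
    exact ⟨ContinuousLinearEquiv.equivOfInverse T T' (fun f => by ext x; simp [hT, hT'])
      fun f => by ext x; simp [hT, hT']⟩
  · have hinf : ∀ {K : Type u} [TopologicalSpace K] [T2Space K], topWeight K = κ → Infinite K := by
      intro K _ _ hw
      by_contra hfin
      rw [not_infinite_iff_finite] at hfin
      rw [topWeight_eq_mk_of_discrete] at hw
      exact not_lt.2 hκ (hw ▸ lt_aleph0_of_finite K)
    have := hinf hw₀
    have := hinf hw₁
    obtain ⟨j₀, hj₀, hex₀, hρ₀⟩ := hs₀.exists_exact
    obtain ⟨j₁, hj₁, hex₁, hρ₁⟩ := hs₁.exists_exact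
    obtain ⟨e'⟩ := nonempty_equiv_of_pullback (j₀ := j₀)
      (ρ₀ := (e : C(derivedSet (Set.univ : Set K₀), ℝ) →L[ℝ]
        C(derivedSet (Set.univ : Set K₁), ℝ)).comp (restrictCLM _)) hj₀
      (fun z => by
        rw [← hex₀ z]
        exact e.map_eq_zero_iff) (e.surjective.comp hρ₀) hj₁ hex₁ hρ₁
      (fun W _ _ _ j ρ hj hex hρ => by
        obtain ⟨P, hP⟩ := hMA.exists_extension_of_hasFiniteHeight hh₀ hw₀ hj hex hρ
          (ContinuousLinearMap.id ℝ _)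
        exact ⟨P, hP⟩)
      (fun W _ _ _ j ρ hj hex hρ => by
        obtain ⟨P, hP⟩ := hMA.exists_extension_of_hasFiniteHeight hh₁ hw₁ hj hex hρ
          (ContinuousLinearMap.id ℝ _)
        exact ⟨P, hP⟩)
    obtain ⟨e₀⟩ := hs₀.nonempty_equiv_prod
    obtain ⟨e₁⟩ := hs₁.nonempty_equiv_prod
    exact ⟨e₀.symm.trans (e'.trans e₁)⟩

end TwistedSum

theorem theorem4p3 (κ : Cardinal.{u}) (hMA : MartinAxiom κ)
    (K₀ K₁ : Type u)
    [TopologicalSpace K₀] [CompactSpace K₀] [T2Space K₀] [SeparableSpace K₀]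
    [TopologicalSpace K₁] [CompactSpace K₁] [T2Space K₁] [SeparableSpace K₁]
    (hs₀ : IsScatteredSpace K₀) (hh₀ : HasFiniteHeight K₀) (hw₀ : topWeight K₀ = κ)
    (hs₁ : IsScatteredSpace K₁) (hh₁ : HasFiniteHeight K₁) (hw₁ : topWeight K₁ = κ) :
    (Nonempty (C(derivedSet (univ : Set K₀), ℝ) ≃L[ℝ] C(derivedSet (univ : Set K₁), ℝ)) →
      Nonempty (C(K₀, ℝ) ≃L[ℝ] C(K₁, ℝ))) ∧
    (Nonempty (C(K₀, ℝ) ≃L[ℝ] C(K₁, ℝ)) →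
      ∀ (X₀ : Type v₀) (X₁ : Type v₁)
        [NormedAddCommGroup X₀] [NormedSpace ℝ X₀] [CompleteSpace X₀]
        [NormedAddCommGroup X₁] [NormedSpace ℝ X₁] [CompleteSpace X₁],
        IsTwistedSum C₀(ℕ, ℝ) X₀ C(K₀, ℝ) → IsTwistedSum C₀(ℕ, ℝ) X₁ C(K₁, ℝ) →
          Nonempty (X₀ ≃L[ℝ] X₁) ∧
          ∀ (Z₀ : Type w₀) (Z₁ : Type w₁)
            [NormedAddCommGroup Z₀] [NormedSpace ℝ Z₀] [CompleteSpace Z₀]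
            [NormedAddCommGroup Z₁] [NormedSpace ℝ Z₁] [CompleteSpace Z₁],
            IsIteratedTwistedSum X₀ Z₀ → IsIteratedTwistedSum X₁ Z₁ →
              Nonempty (Z₀ ≃L[ℝ] Z₁)) := by
  refine ⟨fun ⟨e⟩ => nonempty_equiv_of_derivedSet hMA hs₀ hh₀ hw₀ hs₁ hh₁ hw₁ e, ?_⟩
  rintro ⟨e⟩ X₀ X₁ _ _ _ _ _ _ h₀ h₁
  obtain ⟨e₀⟩ := h₀.nonempty_equiv_prod hMA hh₀ hw₀
  obtain ⟨e₁⟩ := h₁.nonempty_equiv_prod hMA hh₁ hw₁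
  let e' := (ContinuousLinearEquiv.refl ℝ C₀(ℕ, ℝ)).prodCongr e
  refine ⟨⟨e₀.trans (e'.trans e₁.symm)⟩, ?_⟩
  intro Z₀ Z₁ _ _ _ _ _ _ hZ₀ hZ₁
  obtain ⟨e₂⟩ := hZ₀.nonempty_equiv_prod hMA hs₀ hh₀ hw₀ e₀
  obtain ⟨e₃⟩ := hZ₁.nonempty_equiv_prod hMA hs₁ hh₁ hw₁ e₁
  exact ⟨e₂.trans (e'.trans e₃.symm)⟩
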